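/- \textbf{Theorem (Probabilistic Morse Index Convergence).} Let $S$ be a compact $D$-dimensional $C^2$ manifold with boundary which is also a metric space. Give $C^2(S,\mathbb R)$ the $C^2$ topology, i.e. identify $f$ with the triple $(f,\nabla f,H_f)$ of its value, gradient and Hessian in charts, with uniform convergence of all partial derivatives of order $0,1,2$ (in each chart, on compact subsets of its domain). Let $\hat G_n$ ($n\ge 1$) and $G$ be random processes, i.e. maps defined on probability spaces, with values in $C^2(S,\mathbb R)$. Weak convergence $X_n\rightsquigarrow X$ means that $X$ is Borel measurable (with respect to the completed probability) and $\mathbb E^*[h(X_n)]\to\mathbb E[h(X)]$ for every bounded continuous real $h$, where $\mathbb E^*$ is outer expectation and the $X_n$ need not be measurable. For $f\in C^2(S,\mathbb R)$, a point $p$ is critical if $\nabla f(p)=0$; a critical point is a Morse point if $\det H_f(p)\neq 0$, and its Morse index is then the number of negative eigenvalues of $H_f(p)$; $f$ is Morse if all its critical points are Morse points. Let $N_C(f)$ be the number of critical points of $f$; $N_M(f)$ and $N_m(f)$ the numbers of critical points which are local maxima, respectively local minima (strict on a punctured neighbourhood); $N_S(f)$ the number of saddle points, i.e. critical points which are neither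 local maxima, nor local minima, nor undulation points (isolated interior critical points at which the Brouwer degree of $\nabla f$ is $0$); and $N^M_\lambda(f)$ the number of Morse points of Morse index $\lambda$. These numbers take values in $\{0,1,2,\dots\}\cup\{\infty\}$, with its order topology. Assume that \begin{enumerate} \item $(\hat G_n,\nabla\hat G_n,H_{\hat G_n})\rightsquigarrow(G,\nabla G,H_G)$, where $(G,\nabla G,H_G)$ is separable, i.e. it lies almost surely in a separable Borel set; \item almost surely $G$ has no critical point on $\partial S$; \item almost surely $G$ is Morse; \item $N^M_\lambda(G)$ is Borel measurable for every $\lambda\in\mathbb N$. \end{enumerate} Then $N_C(G)<\infty$ almost surely, and $$N_M(\hat G_n)\rightsquigarrow N_M(G),\quad N_m(\hat G_n)\rightsquigarrow N_m(G),\quad N_S(\hat G_n)\rightsquigarrow N_S(G),\quad N_C(\hat G_n)\rightsquigarrow N_C(G),$$ and $N^M_\lambda(\hat G_n)\rightsquigarrow N^M_\lambda(G)$ for every $\lambda\in\{0,\dots,D\}$. -/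

import Mathlib

open Set Filter Topology MeasureTheory
open scoped Manifold UniformConvergence


noncomputable section

namespace MorseConv

/-! ### Outer expectation and weak convergence of possibly non-measurable maps -/

/-- Outer expectation `E^* f`: the infimum of `E g` over the integrable measurable `g ≥ f`.
(It is used for bounded `f` and probability measures only, where this set of numbers is nonempty
and bounded below.) -/
def outerExp {Ω : Type*} [MeasurableSpace Ω] (P : Measure Ω) (f : Ω → ℝ) : ℝ :=
  sInf {c : ℝ | ∃ g : Ω → ℝ, Measurable g ∧ Integrable g P ∧ (∀ ω, f ω ≤ g ω) ∧ c = ∫ ω, g ω ∂P}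

/-- Weak convergence `X n ⇝ Y` in the sense of Hoffmann-Jørgensen: the limit is Borel measurable
(with respect to the completion of its probability space), the maps `X n` are arbitrary, and
`E^* h(X n) → E h(Y)` for every bounded continuous `h`. -/
def WeakConv {𝒳 : Type*} [TopologicalSpace 𝒳] [MeasurableSpace 𝒳]
    {Ω : ℕ → Type*} [∀ n, MeasurableSpace (Ω n)] (P : ∀ n, Measure (Ω n)) (X : ∀ n, Ω n → 𝒳)
    {Ω' : Type*} [MeasurableSpace Ω'] (Q : Measure Ω') (Y : Ω' → 𝒳) : Prop :=
  AEMeasurable Y Q ∧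
    ∀ h : BoundedContinuousFunction 𝒳 ℝ,
      Tendsto (fun n => outerExp (P n) (fun ω => h (X n ω))) atTop (𝓝 (∫ ω, h (Y ω) ∂Q))

/-- `Y` is separable: with probability one it takes its values in a separable Borel set. -/
def IsSeparableRV {𝒳 : Type*} [TopologicalSpace 𝒳] [MeasurableSpace 𝒳]
    {Ω' : Type*} [MeasurableSpace Ω'] (Q : Measure Ω') (Y : Ω' → 𝒳) : Prop :=
  ∃ A : Set 𝒳, MeasurableSet A ∧ TopologicalSpace.IsSeparable A ∧ ∀ᵐ ω ∂Q, Y ω ∈ A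

section Manifold

variable {D : ℕ} {H : Type*} [TopologicalSpace H]
  (I : ModelWithCorners ℝ (EuclideanSpace ℝ (Fin D)) H)
  {S : Type*} [TopologicalSpace S] [ChartedSpace H S]

/-! ### Derivatives in a chart -/

/-- The coordinate expression `f ∘ φ⁻¹` of `f` in the chart `φ = e.extend I`. -/
def localRep (e : OpenPartialHomeomorph S H) (f : S → ℝ) : EuclideanSpace ℝ (Fin D) → ℝ :=
  f ∘ (e.extend I).symm

/-- The vector of first partial derivatives of `f ∘ φ⁻¹` at the coordinate point `y`
(one-sided at boundary points, that is, within the closed model set `range I`). -/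
def gradIn (e : OpenPartialHomeomorph S H) (f : S → ℝ) (y : EuclideanSpace ℝ (Fin D)) :
    EuclideanSpace ℝ (Fin D) :=
  WithLp.toLp 2 fun i =>
    fderivWithin ℝ (localRep I e f) (range I) y (EuclideanSpace.single i 1)

/-- The matrix of second partial derivatives of `f ∘ φ⁻¹` at the coordinate point `y`. -/
def hessIn (e : OpenPartialHomeomorph S H) (f : S → ℝ) (y : EuclideanSpace ℝ (Fin D)) :
    Matrix (Fin D) (Fin D) ℝ :=
  Matrix.of fun i j =>
    iteratedFDerivWithin ℝ 2 (localRep I e f) (range I) y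
      ![EuclideanSpace.single i 1, EuclideanSpace.single j 1]

/-! ### The space `C²(S, ℝ)` with its `C²` topology -/

variable (S) in
/-- Families, indexed by the charts of the `C²` structure, of functions with values in
`ℝ × ℝ^D × ℝ^{D × D}`, with the topology of uniform convergence on the compact subsets of the
domain of each chart. -/
abbrev JetSpace : Type _ :=
  (e : IsManifold.maximalAtlas I 2 S) →
    (S →ᵤ[{K : Set S | IsCompact K ∧ K ⊆ e.1.source}]
      (ℝ × EuclideanSpace ℝ (Fin D) × Matrix (Fin D) (Fin D) ℝ))

/-- The triple `(f, ∇f, H_f)`, read in all charts. -/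
def jet (f : C^2⟮I, S; ℝ⟯) : JetSpace I S := fun e =>
  UniformOnFun.ofFun {K : Set S | IsCompact K ∧ K ⊆ e.1.source} fun x =>
    (f x, gradIn I e.1 f (e.1.extend I x), hessIn I e.1 f (e.1.extend I x))

/-- The `C²` topology: `f` is identified with the triple `(f, ∇f, H_f)`, so that convergence is
uniform convergence of all partial derivatives of order `0, 1, 2`, in every chart and on compact
subsets of its domain. -/
instance c2Topology : TopologicalSpace C^2⟮I, S; ℝ⟯ :=
  TopologicalSpace.induced (jet I) inferInstance

instance c2MeasurableSpace : MeasurableSpace C^2⟮I, S; ℝ⟯ := borel _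

instance c2BorelSpace : BorelSpace C^2⟮I, S; ℝ⟯ := ⟨rfl⟩

/-! ### Critical points and their types -/

/-- `p` is a critical point of `f`. -/
def IsCrit (f : S → ℝ) (p : S) : Prop := mfderiv I 𝓘(ℝ, ℝ) f p = 0

/-- The Hessian matrix of `f` at `p`, in the preferred chart at `p`. (At a critical point another
chart gives a congruent matrix, so rank and signature do not depend on the chart.) -/
def hess (f : S → ℝ) (p : S) : Matrix (Fin D) (Fin D) ℝ :=
  hessIn I (chartAt H p) f (extChartAt I p p)

/-- A Morse point is a non-degenerate critical point. -/
def IsMorsePoint (f : S → ℝ) (p : S) : Prop := IsCrit I f p ∧ (hess I f p).det ≠ 0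

/-- A Morse function has no degenerate critical points (applied to `C²` functions). -/
def IsMorse (f : S → ℝ) : Prop := ∀ p, IsCrit I f p → (hess I f p).det ≠ 0

open scoped Classical in
/-- The Morse index: the number of negative eigenvalues of the Hessian, with multiplicity. -/
def morseIndex (f : S → ℝ) (p : S) : ℕ := (hess I f p).charpoly.roots.countP (· < 0)

/-- `p` is a (strict) local maximum of `f`. -/
def IsStrictLocMax (f : S → ℝ) (p : S) : Prop := ∀ᶠ x in 𝓝[≠] p, f x < f p

/-- `p` is a (strict) local minimum of `f`. -/
def IsStrictLocMin (f : S → ℝ) (p : S) : Prop := ∀ᶠ x in 𝓝[≠] p, f p < f x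

/-- The homological index of `∇f` at the isolated interior critical point `p` is `k`. It is the
Brouwer degree at `0` of the coordinate gradient on a small ball around `p`, that is, the sum of
the signs of the Jacobian determinants over the preimages in the ball of any sufficiently small
regular value `w` of the gradient. -/
def HasHomologicalIndex (f : S → ℝ) (p : S) (k : ℤ) : Prop :=
  ∃ ε > 0,
    Metric.closedBall (extChartAt I p p) ε ⊆ (extChartAt I p).target ∧
    (∀ y ∈ Metric.closedBall (extChartAt I p p) ε,
      gradIn I (chartAt H p) f y = 0 ↔ y = extChartAt I p p) ∧
    ∃ δ > 0, ∀ w : EuclideanSpace ℝ (Fin D), ‖w‖ < δ →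
      (∀ y ∈ Metric.ball (extChartAt I p p) ε,
        gradIn I (chartAt H p) f y = w → (hessIn I (chartAt H p) f y).det ≠ 0) →
      ∑ᶠ y ∈ {y ∈ Metric.ball (extChartAt I p p) ε | gradIn I (chartAt H p) f y = w},
        (SignType.sign (hessIn I (chartAt H p) f y).det : ℤ) = k

/-- An undulation point is a critical point of homological index `0`. -/
def IsUndulation (f : S → ℝ) (p : S) : Prop := IsCrit I f p ∧ HasHomologicalIndex I f p 0

/-- A saddle point is a critical point which is neither a local maximum, nor a local minimum, nor
an undulation point. -/
def IsSaddle (f : S → ℝ) (p : S) : Prop :=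
  IsCrit I f p ∧ ¬ IsStrictLocMax f p ∧ ¬ IsStrictLocMin f p ∧ ¬ IsUndulation I f p

/-! ### The numbers of critical points of each type (infinite if there are infinitely many) -/

/-- Number of critical points. -/
def numCrit (f : S → ℝ) : ℕ∞ := {p | IsCrit I f p}.encard

/-- Number of critical points that are local maxima. -/
def numMax (f : S → ℝ) : ℕ∞ := {p | IsCrit I f p ∧ IsStrictLocMax f p}.encard

/-- Number of critical points that are local minima. -/
def numMin (f : S → ℝ) : ℕ∞ := {p | IsCrit I f p ∧ IsStrictLocMin f p}.encard

/-- Number of saddle points. -/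
def numSaddle (f : S → ℝ) : ℕ∞ := {p | IsSaddle I f p}.encard

/-- Number of Morse points of Morse index `l`. -/
def numMorse (l : ℕ) (f : S → ℝ) : ℕ∞ := {p | IsMorsePoint I f p ∧ morseIndex I f p = l}.encard

end Manifold

end MorseConv

end

noncomputable section

namespace MorseConv

/-! ### Monotonicity of the outer expectation -/

/-! Every count in the theorem is locally constant, in the `C²` topology, at a Morse function `f`
without boundary critical points. Weak convergence then passes through the count, as in a continuous
mapping theorem for maps that are continuous only at almost every value of the limit.

Local constancy. A nondegenerate critical point is a zero of the differential with invertible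
derivative. By a quantitative inverse function theorem, a `C²`-small perturbation has exactly one
critical point nearby, nondegenerate and of the same index (`exists_unique_zero_fderiv`,
`exists_isOpen_eventually_unique_crit`). Away from these points the gradient is bounded below by
compactness, so no new critical points appear (`eventually_forall_not_isCrit`). Hence the critical
points of `f` and of the perturbation correspond bijectively with equal indices
(`eventually_encard_isCrit_eq`). For such functions all the types are read off from the index: a
minimum has index `0`, a maximum has index `D`, every other critical point is a saddle, and
undulation points do not occur, because the degree at a nondegenerate point is `±1`.

Transfer. Only gradients and Hessians on finitely many compact pieces of charts enter, so local
constancy holds for a pseudometrizable topology coarser than the `C²` one. For a bounded function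
`g` of the count, the `k`-Lipschitz minorants of `g` in this pseudometric are continuous and reach
the value of `g` for large `k` wherever `g` is locally constant. Dominated convergence and
monotonicity of the outer expectation give the lower bound on the limit; applied to `-g`, the same
argument gives the upper bound (`WeakConv.map_of_eventually_eq`). No measurability of the
approximating processes is needed. -/

theorem outerExp_mono {Ω : Type*} [MeasurableSpace Ω] (P : Measure Ω) [IsProbabilityMeasure P]
    {f g : Ω → ℝ} {M : ℝ} (hf : ∀ ω, -M ≤ f ω) (hg : ∀ ω, g ω ≤ M) (hfg : ∀ ω, f ω ≤ g ω) :
    outerExp P f ≤ outerExp P g := by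
  unfold outerExp
  refine csInf_le_csInf ⟨-M, ?_⟩ ⟨M, fun _ => M, measurable_const, integrable_const M, hg, by simp⟩ ?_
  · rintro c ⟨u, -, hui, hfu, rfl⟩
    calc -M = ∫ _, -M ∂P := by simp
      _ ≤ ∫ ω, u ω ∂P := integral_mono (integrable_const _) hui fun ω => (hf ω).trans (hfu ω)
  · rintro c ⟨u, hum, hui, hgu, rfl⟩
    exact ⟨u, hum, hui, fun ω => (hfg ω).trans (hgu ω), rfl⟩

/-! ### Lipschitz minorants -/

/-- The largest `k`-Lipschitz function `φ` on `Z` with `φ ∘ J ≤ g`. -/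
def lipMinorant {X Z : Type*} [PseudoMetricSpace Z] (J : X → Z) (g : X → ℝ) (k : ℕ) (z : Z) : ℝ :=
  ⨅ y, (g y + k * dist z (J y))

section LipMinorant

variable {X Z : Type*} [PseudoMetricSpace Z] {J : X → Z} {g : X → ℝ} {M : ℝ}

theorem bddBelow_lipMinorant (hg : ∀ x, |g x| ≤ M) (k : ℕ) (z : Z) :
    BddBelow (range fun y => g y + k * dist z (J y)) := by
  refine ⟨-M, ?_⟩
  rintro _ ⟨y, rfl⟩
  have := (abs_le.1 (hg y)).1
  have : 0 ≤ (k : ℝ) * dist z (J y) := by positivity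
  dsimp only
  linarith

theorem lipMinorant_le (hg : ∀ x, |g x| ≤ M) (k : ℕ) (x : X) : lipMinorant J g k (J x) ≤ g x := by
  refine (ciInf_le (bddBelow_lipMinorant (J := J) hg k (J x)) x).trans_eq ?_
  simp

theorem neg_le_lipMinorant [Nonempty X] (hg : ∀ x, |g x| ≤ M) (k : ℕ) (z : Z) :
    -M ≤ lipMinorant J g k z := by
  refine le_ciInf fun y => ?_
  have := (abs_le.1 (hg y)).1
  have : 0 ≤ (k : ℝ) * dist z (J y) := by positivity
  linarith

theorem abs_lipMinorant_le (hg : ∀ x, |g x| ≤ M) (k : ℕ) (x : X) :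
    |lipMinorant J g k (J x)| ≤ M :=
  have : Nonempty X := ⟨x⟩
  abs_le.2 ⟨neg_le_lipMinorant hg k _, (lipMinorant_le hg k x).trans (abs_le.1 (hg x)).2⟩

theorem continuous_lipMinorant [Nonempty X] (hg : ∀ x, |g x| ≤ M) (k : ℕ) :
    Continuous (lipMinorant J g k) := by
  refine (LipschitzWith.of_le_add_mul (k : NNReal) fun z z' => ?_).continuous
  rw [← sub_le_iff_le_add]
  refine le_ciInf fun y => ?_
  have h1 := ciInf_le (bddBelow_lipMinorant (J := J) hg k z) y
  have h2 : (k : ℝ) * dist z (J y) ≤ k * (dist z z' + dist z' (J y)) :=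
    mul_le_mul_of_nonneg_left (dist_triangle _ _ _) (Nat.cast_nonneg k)
  simp only [lipMinorant, NNReal.coe_natCast] at *
  linarith

/-- Points within `ε` of `x` contribute at least `g x` to the infimum, by local constancy. For the
others the penalty is at least `k * ε`, which beats the oscillation `2 * M` once `k` is large. -/
theorem eventually_lipMinorant_eq (hg : ∀ x, |g x| ≤ M) {x : X}
    (hx : ∀ᶠ y in comap J (𝓝 (J x)), g y = g x) :
    ∀ᶠ k : ℕ in atTop, lipMinorant J g k (J x) = g x := by
  have : Nonempty X := ⟨x⟩
  rw [eventually_comap, Metric.eventually_nhds_iff] at hx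
  obtain ⟨ε, hε, h⟩ := hx
  obtain ⟨k₀, hk₀⟩ := exists_nat_gt (2 * M / ε)
  filter_upwards [eventually_ge_atTop k₀] with k hk
  refine le_antisymm (lipMinorant_le hg k x) (le_ciInf fun y => ?_)
  by_cases hy : dist (J y) (J x) < ε
  · rw [h hy y rfl]
    have : 0 ≤ (k : ℝ) * dist (J x) (J y) := by positivity
    linarith
  · rw [not_lt, dist_comm] at hy
    have h1 : 2 * M < k₀ * ε := (div_lt_iff₀ hε).1 hk₀
    have h2 : (k₀ : ℝ) * ε ≤ k * dist (J x) (J y) := by gcongr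
    have := abs_le.1 (hg x)
    have := abs_le.1 (hg y)
    linarith

end LipMinorant

/-! ### A mapping theorem for locally constant functionals -/

section Mapping

variable {X Z : Type*} [TopologicalSpace X] [PseudoMetricSpace Z] {J : X → Z}

theorem isOpen_eventually_comap (hJ : Continuous J) (p : X → Prop) :
    IsOpen {x | ∀ᶠ y in comap J (𝓝 (J x)), p y} := by
  simp only [eventually_comap]
  exact isOpen_setOfPred_eventually_nhds.preimage hJ

variable [MeasurableSpace X] [BorelSpace X] {Ω' : Type*} [MeasurableSpace Ω'] {Q : Measure Ω'}
  {Y : Ω' → X}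

/-- The points near which `N` is constantly `t` form an open set. On the union of these sets `N` is
measurable since `T` is countable, and `Y` almost surely lies in it, so `N` may be replaced by a
constant elsewhere. -/
theorem aemeasurable_of_eventually_eq (hJ : Continuous J) {T : Type*} [MeasurableSpace T]
    [Countable T] (N : X → T) (hY : AEMeasurable Y Q)
    (hN : ∀ᵐ ω ∂Q, ∀ᶠ x in comap J (𝓝 (J (Y ω))), N x = N (Y ω)) :
    AEMeasurable (fun ω => N (Y ω)) Q := by
  classical
  rcases isEmpty_or_nonempty T with hT | ⟨⟨t₀⟩⟩
  · have : IsEmpty Ω' := ⟨fun ω => hT.elim (N (Y ω))⟩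
    exact (measurable_of_empty _).aemeasurable
  let V : T → Set X := fun t => {x | ∀ᶠ y in comap J (𝓝 (J x)), N y = t}
  have hV : ∀ t, IsOpen (V t) := fun t => isOpen_eventually_comap hJ _
  have hVN : ∀ {t x}, x ∈ V t → N x = t := fun {t x} h => by
    have h : ∀ᶠ y in comap J (𝓝 (J x)), N y = t := h
    rw [eventually_comap] at h
    exact h.self_of_nhds x rfl
  let N' : X → T := fun x => if x ∈ ⋃ t, V t then N x else t₀
  have hN' : Measurable N' := by
    refine measurable_to_countable' fun t => ?_
    have : N' ⁻¹' {t} = V t ∪ ((⋃ t, V t)ᶜ ∩ {_x | t₀ = t}) := by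
      ext x
      by_cases hx : x ∈ ⋃ t, V t
      · obtain ⟨s, hs⟩ := mem_iUnion.1 hx
        have h1 : N' x = s := by simp only [N', if_pos hx, hVN hs]
        have h2 : x ∈ V t ↔ s = t :=
          ⟨fun h => (hVN hs).symm.trans (hVN h), fun h => h ▸ hs⟩
        simp only [mem_preimage, mem_singleton_iff, h1, mem_union, h2, mem_inter_iff,
          mem_compl_iff, hx, not_true_eq_false, false_and, or_false]
      · have h1 : N' x = t₀ := by simp only [N', if_neg hx]
        have h2 : x ∉ V t := fun h => hx (mem_iUnion.2 ⟨t, h⟩)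
        simp only [mem_preimage, mem_singleton_iff, h1, mem_union, h2, mem_inter_iff,
          mem_compl_iff, hx, not_false_eq_true, true_and, false_or, mem_ofPred_eq]
    rw [this]
    exact (hV t).measurableSet.union
      ((isOpen_iUnion hV).measurableSet.compl.inter (MeasurableSet.const _))
  refine (hN'.comp_aemeasurable hY).congr ?_
  filter_upwards [hN] with ω hω
  have : Y ω ∈ ⋃ t, V t := mem_iUnion.2 ⟨_, hω⟩
  simp only [Function.comp_apply, N', if_pos this]

theorem exists_boundedContinuous_lt_integral [IsProbabilityMeasure Q] (hJ : Continuous J)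
    (hY : AEMeasurable Y Q) {g : X → ℝ}
    {M : ℝ} (hg : ∀ x, |g x| ≤ M)
    (hgY : ∀ᵐ ω ∂Q, ∀ᶠ x in comap J (𝓝 (J (Y ω))), g x = g (Y ω)) {c : ℝ}
    (hc : c < ∫ ω, g (Y ω) ∂Q) :
    ∃ h : BoundedContinuousFunction X ℝ, (∀ x, |h x| ≤ M) ∧ (∀ x, h x ≤ g x) ∧
      c < ∫ ω, h (Y ω) ∂Q := by
  have hne : Nonempty X := (nonempty_of_isProbabilityMeasure Q).map Y
  let φ : ℕ → BoundedContinuousFunction X ℝ := fun k =>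
    BoundedContinuousFunction.ofNormedAddCommGroup (fun x => lipMinorant J g k (J x))
      ((continuous_lipMinorant hg k).comp hJ) M fun x => abs_lipMinorant_le hg k x
  have hlim : Tendsto (fun k => ∫ ω, φ k (Y ω) ∂Q) atTop (𝓝 (∫ ω, g (Y ω) ∂Q)) := by
    refine tendsto_integral_of_dominated_convergence (fun _ => M) (fun k => ?_)
      (integrable_const M) (fun k => .of_forall fun ω => abs_lipMinorant_le hg k _) ?_
    · exact ((φ k).continuous.measurable.comp_aemeasurable hY).aestronglyMeasurable
    · filter_upwards [hgY] with ω hω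
      exact tendsto_const_nhds.congr' ((eventually_lipMinorant_eq hg hω).mono fun k h => h.symm)
  obtain ⟨k, hk⟩ := (hlim.eventually (lt_mem_nhds hc)).exists
  exact ⟨φ k, fun x => abs_lipMinorant_le hg k x, fun x => lipMinorant_le hg k x, hk⟩

/-- Weak convergence is preserved by a map which is almost surely locally constant at the limit,
with respect to a pseudometrizable topology coarser than the given one. -/
theorem WeakConv.map_of_eventually_eq {Ω : ℕ → Type*} [∀ n, MeasurableSpace (Ω n)]
    {P : ∀ n, Measure (Ω n)} [∀ n, IsProbabilityMeasure (P n)] [IsProbabilityMeasure Q]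
    {U : ∀ n, Ω n → X} (hJ : Continuous J) {T : Type*} [TopologicalSpace T]
    [MeasurableSpace T] [Countable T] (N : X → T) (hU : WeakConv P U Q Y)
    (hN : ∀ᵐ ω ∂Q, ∀ᶠ x in comap J (𝓝 (J (Y ω))), N x = N (Y ω)) :
    WeakConv P (fun n ω => N (U n ω)) Q (fun ω => N (Y ω)) := by
  refine ⟨aemeasurable_of_eventually_eq hJ N hU.1 hN, fun h => ?_⟩
  have hb : ∀ x, |h (N x)| ≤ ‖h‖ := fun x => h.norm_coe_le_norm _
  have hbn : ∀ x, |-h (N x)| ≤ ‖h‖ := fun x => by rw [abs_neg]; exact hb x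
  refine tendsto_order.2 ⟨fun c hc => ?_, fun c hc => ?_⟩
  · obtain ⟨u, hu, hug, huc⟩ := exists_boundedContinuous_lt_integral hJ hU.1 hb
      (hN.mono fun ω hω => hω.mono fun x hx => by rw [hx]) hc
    filter_upwards [(hU.2 u).eventually (lt_mem_nhds huc)] with n hn
    exact hn.trans_le (outerExp_mono _ (fun ω => (abs_le.1 (hu _)).1)
      (fun ω => (abs_le.1 (hb _)).2) fun ω => hug _)
  -- The outer expectation is not linear, so the sign change happens before it is taken: a
  -- continuous minorant `u` of `-h ∘ N` gives the continuous majorant `-u` of `h ∘ N`.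
  · have hc' : -c < ∫ ω, -h (N (Y ω)) ∂Q := by rw [integral_neg]; linarith
    obtain ⟨u, hu, hug, huc⟩ := exists_boundedContinuous_lt_integral hJ hU.1 hbn
      (hN.mono fun ω hω => hω.mono fun x hx => by rw [hx]) hc'
    have huc' : ∫ ω, (-u) (Y ω) ∂Q < c := by
      simp only [BoundedContinuousFunction.coe_neg, Pi.neg_apply]
      rw [integral_neg]
      linarith
    filter_upwards [(hU.2 (-u)).eventually (gt_mem_nhds huc')] with n hn
    refine (outerExp_mono _ (fun ω => (abs_le.1 (hb _)).1) (fun ω => ?_) fun ω => ?_).trans_lt hn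
    · have := (abs_le.1 (hu (U n ω))).1
      simp only [BoundedContinuousFunction.coe_neg, Pi.neg_apply]
      linarith
    · have := hug (U n ω)
      simp only [BoundedContinuousFunction.coe_neg, Pi.neg_apply]
      linarith

/-- A version of `WeakConv.map_of_eventually_eq` for a pseudometrizable target of `J`. -/
theorem WeakConv.map_of_eventually_eq' {X Z : Type*} [TopologicalSpace X] [MeasurableSpace X]
    [BorelSpace X] [TopologicalSpace Z] [TopologicalSpace.PseudoMetrizableSpace Z] {J : X → Z}
    {Ω' : Type*} [MeasurableSpace Ω'] {Q : Measure Ω'} {Y : Ω' → X}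
    {Ω : ℕ → Type*} [∀ n, MeasurableSpace (Ω n)]
    {P : ∀ n, Measure (Ω n)} [∀ n, IsProbabilityMeasure (P n)] [IsProbabilityMeasure Q]
    {U : ∀ n, Ω n → X} (hJ : Continuous J) {T : Type*} [TopologicalSpace T]
    [MeasurableSpace T] [Countable T] (N : X → T) (hU : WeakConv P U Q Y)
    (hN : ∀ᵐ ω ∂Q, ∀ᶠ x in comap J (𝓝 (J (Y ω))), N x = N (Y ω)) :
    WeakConv P (fun n ω => N (U n ω)) Q (fun ω => N (Y ω)) := by
  let := TopologicalSpace.pseudoMetrizableSpacePseudoMetric Z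
  exact hU.map_of_eventually_eq hJ N hN

end Mapping

/-! ### Symmetric bilinear forms and their matrices -/

section Bilinear

variable {D : ℕ}

local notation "𝔼" => EuclideanSpace ℝ (Fin D)
local notation "Bil" => EuclideanSpace ℝ (Fin D) →L[ℝ] EuclideanSpace ℝ (Fin D) →L[ℝ] ℝ

/-- The Gram matrix of a bilinear form in the standard basis. -/
def gram (B : Bil) : Matrix (Fin D) (Fin D) ℝ :=
  Matrix.of fun i j => B (EuclideanSpace.single i 1) (EuclideanSpace.single j 1)

theorem gram_sub_apply (A B : Bil) (i j : Fin D) :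
    gram (A - B) i j = gram A i j - gram B i j := rfl

/-- The quadratic form `x ↦ B x x`. -/
def quadForm (B : Bil) : QuadraticForm ℝ 𝔼 :=
  LinearMap.BilinMap.toQuadraticMap
    (LinearMap.mk₂ ℝ (fun x y => B x y) (by simp) (by simp) (by simp) (by simp))

@[simp] theorem quadForm_apply (B : Bil) (x : 𝔼) : quadForm B x = B x x := rfl

theorem sum_smul_single (x : 𝔼) : ∑ i, x i • EuclideanSpace.single i (1 : ℝ) = x := by
  ext j
  simp [Finset.sum_apply, Pi.single_apply]

theorem apply_eq_sum (L : 𝔼 →L[ℝ] ℝ) (x : 𝔼) :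
    L x = ∑ i, x i * L (EuclideanSpace.single i 1) := by
  conv_lhs => rw [← sum_smul_single x]
  simp only [map_sum, map_smul, smul_eq_mul]

theorem apply_apply_eq_gram (B : Bil) (x y : 𝔼) :
    B x y = ∑ i, x i * ∑ j, gram B i j * y j := by
  rw [← ContinuousLinearMap.flip_apply, apply_eq_sum]
  refine Finset.sum_congr rfl fun i _ => ?_
  rw [ContinuousLinearMap.flip_apply, apply_eq_sum]
  simp only [gram, Matrix.of_apply, mul_comm]

theorem norm_le_of_gram {B : Bil} {c : ℝ} (hc : 0 ≤ c) (h : ∀ i j, |gram B i j| ≤ c) :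
    ‖B‖ ≤ D * D * c := by
  refine B.opNorm_le_bound₂ (by positivity) fun x y => ?_
  rw [apply_apply_eq_gram]
  calc ‖∑ i, x i * ∑ j, gram B i j * y j‖
      ≤ ∑ _i : Fin D, ‖x‖ * ∑ _j : Fin D, c * ‖y‖ := by
        refine (norm_sum_le _ _).trans (Finset.sum_le_sum fun i _ => ?_)
        rw [norm_mul]
        refine mul_le_mul (PiLp.norm_apply_le x i) ?_ (norm_nonneg _) (norm_nonneg _)
        refine (norm_sum_le _ _).trans (Finset.sum_le_sum fun j _ => ?_)
        rw [norm_mul]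
        exact mul_le_mul (h i j) (PiLp.norm_apply_le y j) (norm_nonneg _) hc
    _ = D * D * c * ‖x‖ * ‖y‖ := by simp; ring

theorem gram_isHermitian {B : Bil} (hB : ∀ x y, B x y = B y x) : (gram B).IsHermitian := by
  ext i j
  simp [gram, hB (EuclideanSpace.single i 1)]

theorem apply_apply_eq_inner (B : Bil) (x y : 𝔼) :
    B x y = inner ℝ x (WithLp.toLp 2 (Matrix.mulVec (gram B) y.ofLp)) := by
  rw [apply_apply_eq_gram, PiLp.inner_apply]
  simp [Matrix.mulVec, dotProduct, mul_comm]

theorem det_gram_ne_zero_iff (B : Bil) : (gram B).det ≠ 0 ↔ ∀ y, (∀ x, B x y = 0) → y = 0 := by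
  rw [Ne, ← Matrix.exists_mulVec_eq_zero_iff]
  push Not
  constructor
  · intro h y hy
    by_contra hne
    refine h y.ofLp (fun h0 => hne (by ext i; simp [h0])) ?_
    have := hy (WithLp.toLp 2 (Matrix.mulVec (gram B) y.ofLp))
    rw [apply_apply_eq_inner, inner_self_eq_zero] at this
    simpa using this
  · intro h v hv h0
    refine hv ?_
    have := h (WithLp.toLp 2 v) fun x => by rw [apply_apply_eq_inner]; simp [h0]
    simpa using this

theorem quadForm_equivalent {B : Bil} (hB : ∀ x y, B x y = B y x) :
    QuadraticMap.Equivalent (quadForm B)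
      (QuadraticMap.weightedSumSquares ℝ (gram_isHermitian hB).eigenvalues) := by
  set hA := gram_isHermitian hB
  let b := hA.eigenvectorBasis
  refine ⟨⟨b.toBasis.equivFun, fun x => ?_⟩⟩
  have key : ∀ i j, B (b i) (b j) = if i = j then hA.eigenvalues j else 0 := fun i j => by
    rw [apply_apply_eq_inner, hA.mulVec_eigenvectorBasis j, WithLp.toLp_smul, inner_smul_right,
      orthonormal_iff_ite.1 b.orthonormal]
    simp
  have hx : x = ∑ i, b.toBasis.equivFun x i • b i := by
    conv_lhs => rw [← b.toBasis.sum_equivFun x]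
    simp
  have key' : ∀ c : Fin D → ℝ,
      B (∑ i, c i • b i) (∑ i, c i • b i) = ∑ i, hA.eigenvalues i * (c i * c i) := fun c => by
    simp only [map_sum, map_smul, sum_apply, smul_apply, key, smul_eq_mul, mul_ite, mul_zero,
      Finset.sum_ite_eq', Finset.mem_univ, if_true]
    exact Finset.sum_congr rfl fun i _ => by ring
  rw [quadForm_apply, hx, key', ← hx]
  exact QuadraticMap.weightedSumSquares_apply _ _

open scoped Classical in
-- An orthonormal eigenbasis diagonalises the form, and Sylvester's law makes the number of negative
-- coefficients an invariant. The basis-free `sigNeg` is the convenient form of the index for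
-- perturbations and chart changes.
theorem countP_roots_charpoly_gram {B : Bil} (hB : ∀ x y, B x y = B y x) :
    (gram B).charpoly.roots.countP (· < 0) = sigNeg (quadForm B) := by
  rw [QuadraticForm.sigNeg_of_equiv_weightedSumSquares (quadForm_equivalent hB),
    (gram_isHermitian hB).roots_charpoly_eq_eigenvalues, Multiset.countP_map,
    Set.ncard_eq_toFinset_card']
  simp [Finset.card_def, Finset.filter_val]

/-- A symmetric bilinear form with trivial kernel. -/
structure IsNondeg (B : Bil) : Prop where
  symm : ∀ x y, B x y = B y x
  eq_zero : ∀ x, B x = 0 → x = 0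

theorem isNondeg_iff_det {B : Bil} (hB : ∀ x y, B x y = B y x) :
    IsNondeg B ↔ (gram B).det ≠ 0 := by
  rw [det_gram_ne_zero_iff]
  constructor
  · intro h y hy
    exact h.eq_zero y (by ext x; rw [hB, hy]; rfl)
  · intro h
    exact ⟨hB, fun x hx => h x fun y => by rw [hB, hx]; rfl⟩

theorem finrank_radical_eq_zero_iff {B : Bil} (hB : ∀ x y, B x y = B y x) :
    Module.finrank ℝ (quadForm B).radical = 0 ↔ IsNondeg B := by
  have hmem : ∀ x, x ∈ (quadForm B).radical ↔ B x = 0 := fun x => by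
    rw [QuadraticMap.mem_radical_iff']
    constructor
    · rintro ⟨h0, h⟩
      ext y
      have := h y
      simp only [quadForm_apply, map_add, add_apply] at this h0
      rw [hB y x, h0] at this
      simp only [zero_apply]
      linarith
    · intro h
      refine ⟨by simp [h], fun y => ?_⟩
      simp [h, hB y x]
  rw [Submodule.finrank_eq_zero, Submodule.eq_bot_iff]
  exact ⟨fun h => ⟨hB, fun x hx => h x ((hmem x).2 hx)⟩, fun h x hx => h.eq_zero x ((hmem x).1 hx)⟩

theorem IsNondeg.sigPos_add_sigNeg {B : Bil} (hB : IsNondeg B) :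
    sigPos (quadForm B) + sigNeg (quadForm B) = D := by
  have := QuadraticForm.sigPos_add_sigNeg_add_radical (Q := quadForm B)
  rw [(finrank_radical_eq_zero_iff hB.symm).2 hB] at this
  simpa using this

/-- A form which is positive definite on a subspace is coercive there. -/
theorem exists_coercive {B : Bil} {V : Submodule ℝ 𝔼} (hV : ∀ x ∈ V, x ≠ 0 → 0 < B x x) :
    ∃ c > 0, ∀ x ∈ V, c * ‖x‖ ^ 2 ≤ B x x := by
  have hK : IsCompact (Metric.sphere (0 : 𝔼) 1 ∩ V) :=
    (isCompact_sphere 0 1).inter_right V.closed_of_finiteDimensional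
  have hcont : Continuous fun x : 𝔼 => B x x := by fun_prop
  have hne : ∀ x ∈ V, x ≠ 0 → ‖x‖⁻¹ • x ∈ Metric.sphere (0 : 𝔼) 1 ∩ V := fun x hx h0 =>
    ⟨by simp [norm_smul, h0], V.smul_mem _ hx⟩
  obtain hem | hnon := (Metric.sphere (0 : 𝔼) 1 ∩ V).eq_empty_or_nonempty
  · refine ⟨1, one_pos, fun x hx => ?_⟩
    by_cases h0 : x = 0
    · simp [h0]
    · have := hne x hx h0
      rw [hem] at this
      exact this.elim
  · obtain ⟨m, hm, hmin⟩ := hK.exists_isMinOn hnon hcont.continuousOn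
    have hm0 : m ≠ 0 := by
      rintro rfl
      simpa using hm.1
    refine ⟨B m m, hV m hm.2 hm0, fun x hx => ?_⟩
    by_cases h0 : x = 0
    · simp [h0]
    · have h1 : B m m ≤ B (‖x‖⁻¹ • x) (‖x‖⁻¹ • x) := hmin (hne x hx h0)
      have h2 : 0 < ‖x‖ := norm_pos_iff.2 h0
      simp only [map_smul, smul_apply, smul_eq_mul] at h1
      calc B m m * ‖x‖ ^ 2 ≤ (‖x‖⁻¹ * (‖x‖⁻¹ * B x x)) * ‖x‖ ^ 2 := by gcongr
        _ = B x x := by field_simp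

/-- On a positive definite subspace of maximal dimension `B` is coercive with some constant `c`; a
perturbation of norm less than `c` stays positive definite there. -/
theorem exists_sigPos_le_of_norm_sub_lt (B : Bil) :
    ∃ c > 0, ∀ B' : Bil, ‖B' - B‖ < c → sigPos (quadForm B) ≤ sigPos (quadForm B') := by
  obtain ⟨V, hV, hpos⟩ := exists_finrank_eq_sigPos_and_posDef (quadForm B)
  obtain ⟨c, hc, h⟩ := exists_coercive (B := B) (V := V) fun x hx h0 => by
    simpa using hpos ⟨x, hx⟩ (by simpa using h0)
  refine ⟨c, hc, fun B' hB' => ?_⟩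
  rw [← hV]
  refine le_sigPos_of_posDef _ fun x hx => ?_
  have hx0 : 0 < ‖(x : 𝔼)‖ := norm_pos_iff.2 (by simpa using hx)
  have h1 := h x x.2
  have h2 : ‖(B' - B) x x‖ ≤ ‖B' - B‖ * ‖(x : 𝔼)‖ * ‖(x : 𝔼)‖ := (B' - B).le_opNorm₂ _ _
  have h3 : ‖B' - B‖ * ‖(x : 𝔼)‖ * ‖(x : 𝔼)‖ < c * ‖(x : 𝔼)‖ * ‖(x : 𝔼)‖ := by gcongr
  have h4 := (abs_le.1 (h2.trans h3.le)).1
  have h5 := (neg_le_abs ((B' - B) x x)).trans_lt (h2.trans_lt h3)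
  simp only [sub_apply] at h5
  simp only [QuadraticMap.restrict_apply, quadForm_apply]
  nlinarith

theorem quadForm_neg (B : Bil) : quadForm (-B) = -quadForm B := by
  ext x
  simp

theorem IsNondeg.neg {B : Bil} (hB : IsNondeg B) : IsNondeg (-B) :=
  ⟨fun x y => by simp [hB.symm x y], fun x hx => hB.eq_zero x (by simpa using hx)⟩

/-- Nondegeneracy and index are stable under small perturbations. -/
theorem IsNondeg.exists_stable {B : Bil} (hB : IsNondeg B) :
    ∃ c > 0, ∀ B' : Bil, (∀ x y, B' x y = B' y x) → ‖B' - B‖ < c →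
      IsNondeg B' ∧ sigNeg (quadForm B') = sigNeg (quadForm B) := by
  obtain ⟨c₁, hc₁, h₁⟩ := exists_sigPos_le_of_norm_sub_lt B
  obtain ⟨c₂, hc₂, h₂⟩ := exists_sigPos_le_of_norm_sub_lt (-B)
  refine ⟨min c₁ c₂, lt_min hc₁ hc₂, fun B' hs hB' => ?_⟩
  have k₁ := h₁ B' (hB'.trans_le (min_le_left _ _))
  have k₂ := h₂ (-B') (by
    rw [show -B' - -B = -(B' - B) by abel]
    exact (norm_neg (B' - B)).trans_lt (hB'.trans_le (min_le_right _ _)))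
  rw [quadForm_neg, quadForm_neg, sigPos_neg, sigPos_neg] at k₂
  -- Neither the positive nor the negative part of the signature can drop. For `B` they already add
  -- up to `D`, so for `B'` both are unchanged and the radical is zero.
  have h3 := hB.sigPos_add_sigNeg
  have h4 := QuadraticForm.sigPos_add_sigNeg_add_radical (Q := quadForm B')
  rw [finrank_euclideanSpace_fin] at h4
  exact ⟨(finrank_radical_eq_zero_iff hs).1 (by omega), by omega⟩

/-- Sylvester's law of inertia for congruent forms. -/
theorem IsNondeg.congr {B B' : Bil} (hB : IsNondeg B) (T : 𝔼 ≃L[ℝ] 𝔼)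
    (h : ∀ x y, B' x y = B (T x) (T y)) :
    IsNondeg B' ∧ sigNeg (quadForm B') = sigNeg (quadForm B) := by
  refine ⟨⟨fun x y => by rw [h, h, hB.symm], fun x hx => ?_⟩, ?_⟩
  · have : T x = 0 := hB.eq_zero _ (by
      ext y
      have := h x (T.symm y)
      rw [hx] at this
      simpa using this.symm)
    simpa using this
  · exact QuadraticMap.Equivalent.sigNeg_eq ⟨⟨T.toLinearEquiv, fun x => by
      simp [h]⟩⟩

theorem IsNondeg.sigNeg_eq_zero_iff {B : Bil} (hB : IsNondeg B) :
    sigNeg (quadForm B) = 0 ↔ ∃ c > 0, ∀ x, c * ‖x‖ ^ 2 ≤ B x x := by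
  constructor
  · intro h
    obtain ⟨V, hV, hpos⟩ := exists_finrank_eq_sigPos_and_posDef (quadForm B)
    have h1 := hB.sigPos_add_sigNeg
    have hVt : V = ⊤ := Submodule.eq_top_of_finrank_eq (by
      rw [finrank_euclideanSpace_fin]; omega)
    obtain ⟨c, hc, h⟩ := exists_coercive (B := B) (V := V) fun x hx h0 => by
      simpa using hpos ⟨x, hx⟩ (by simpa using h0)
    exact ⟨c, hc, fun x => h x (by simp [hVt])⟩
  · rintro ⟨c, hc, h⟩
    have h1 := hB.sigPos_add_sigNeg
    have h2 : Module.finrank ℝ (⊤ : Submodule ℝ 𝔼) ≤ sigPos (quadForm B) :=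
      le_sigPos_of_posDef _ fun x hx => by
        have hx0 : 0 < ‖(x : 𝔼)‖ := norm_pos_iff.2 (by simpa using hx)
        exact lt_of_lt_of_le (by positivity) (h x)
    rw [finrank_top, finrank_euclideanSpace_fin] at h2
    omega

theorem exists_neg_of_sigNeg_ne_zero {B : Bil} (h : sigNeg (quadForm B) ≠ 0) :
    ∃ v, B v v < 0 := by
  by_contra! hn
  obtain ⟨V, hV, hpos⟩ := exists_finrank_eq_sigNeg_and_negDef (quadForm B)
  have : V ≠ ⊥ := by
    rintro rfl
    rw [finrank_bot] at hV
    exact h hV.symm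
  obtain ⟨x, hx, h0⟩ := Submodule.exists_mem_ne_zero_of_ne_bot this
  have h1 : 0 < -(B x x) := by simpa using hpos ⟨x, hx⟩ (by simpa using h0)
  linarith [hn x]

end Bilinear

section SecondOrder

/-! ### Second derivative test -/

section Test

variable {E : Type*} [NormedAddCommGroup E] [NormedSpace ℝ E] {g : E → ℝ} {y₀ : E}
  {B : E →L[ℝ] E →L[ℝ] ℝ}

/-- Along the segment `t ↦ y₀ + t • v` the derivative of `g` is `t * B v v` up to an error of at
most `t * (c / 2) * ‖v‖ ^ 2`, hence positive. The neighbourhood does not depend on the direction of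
`v`, so the lemma serves both a coercive form and a single positive direction. -/
theorem eventually_lt_of_coercive_direction {c : ℝ} (hc : 0 < c)
    (hg : ∀ᶠ y in 𝓝 y₀, DifferentiableAt ℝ g y) (h0 : fderiv ℝ g y₀ = 0)
    (hB : HasFDerivAt (fderiv ℝ g) B y₀) :
    ∀ᶠ v in 𝓝 (0 : E), v ≠ 0 → c * ‖v‖ ^ 2 ≤ B v v → g y₀ < g (y₀ + v) := by
  have h1 := (hasFDerivAt_iff_isLittleO_nhds_zero.1 hB).def (half_pos hc)
  have h2 : ∀ᶠ v in 𝓝 (0 : E), DifferentiableAt ℝ g (y₀ + v) := by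
    have : Tendsto (fun v : E => y₀ + v) (𝓝 0) (𝓝 y₀) := by
      have : Continuous fun v : E => y₀ + v := by fun_prop
      simpa using this.tendsto 0
    exact this.eventually hg
  obtain ⟨r, hr, h⟩ := Metric.eventually_nhds_iff_ball.1 (h1.and h2)
  filter_upwards [Metric.ball_mem_nhds (0 : E) hr] with v hv hv0 hvB
  have hmem : ∀ t ∈ Icc (0 : ℝ) 1, t • v ∈ Metric.ball (0 : E) r := fun t ht => by
    rw [mem_ball_zero_iff] at hv ⊢
    rw [norm_smul, Real.norm_of_nonneg ht.1]
    exact (mul_le_of_le_one_left (norm_nonneg _) ht.2).trans_lt hv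
  have hder : ∀ t ∈ Icc (0 : ℝ) 1,
      HasDerivAt (fun t : ℝ => g (y₀ + t • v)) (fderiv ℝ g (y₀ + t • v) v) t := fun t ht => by
    have e : HasDerivAt (fun t : ℝ => y₀ + t • v) v t := by
      simpa using ((hasDerivAt_id t).smul_const v).const_add y₀
    exact (h _ (hmem t ht)).2.hasFDerivAt.comp_hasDerivAt t e
  have hmono : StrictMonoOn (fun t : ℝ => g (y₀ + t • v)) (Icc 0 1) := by
    refine strictMonoOn_of_deriv_pos (convex_Icc 0 1)
      (fun t ht => (hder t ht).continuousAt.continuousWithinAt) fun t ht => ?_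
    rw [interior_Icc] at ht
    have ht' : t ∈ Icc (0 : ℝ) 1 := Ioo_subset_Icc_self ht
    rw [(hder t ht').deriv]
    have k1 := (h _ (hmem t ht')).1
    rw [h0, sub_zero, norm_smul, Real.norm_of_nonneg ht.1.le] at k1
    have k2 := ((fderiv ℝ g (y₀ + t • v) - B (t • v)).le_opNorm v).trans
      (mul_le_mul_of_nonneg_right k1 (norm_nonneg v))
    have k3 := (abs_le.1 k2).1
    simp only [sub_apply, map_smul, smul_apply, smul_eq_mul] at k3
    have k4 : t * (c * ‖v‖ ^ 2) ≤ t * B v v := by gcongr; exact ht.1.le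
    have k5 : 0 < t * (c * ‖v‖ ^ 2) := by
      have := norm_pos_iff.2 hv0
      have := ht.1
      positivity
    nlinarith
  simpa using hmono (left_mem_Icc.2 zero_le_one) (right_mem_Icc.2 zero_le_one) one_pos

theorem eventually_lt_of_coercive {c : ℝ} (hc : 0 < c)
    (hg : ∀ᶠ y in 𝓝 y₀, DifferentiableAt ℝ g y) (h0 : fderiv ℝ g y₀ = 0)
    (hB : HasFDerivAt (fderiv ℝ g) B y₀) (hcB : ∀ v, c * ‖v‖ ^ 2 ≤ B v v) :
    ∀ᶠ y in 𝓝 y₀, y ≠ y₀ → g y₀ < g y := by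
  have : Tendsto (fun y : E => y - y₀) (𝓝 y₀) (𝓝 0) := by
    have : Continuous fun y : E => y - y₀ := by fun_prop
    simpa using this.tendsto y₀
  filter_upwards [this.eventually (eventually_lt_of_coercive_direction hc hg h0 hB)] with y hy hne
  simpa using hy (sub_ne_zero.2 hne) (hcB _)

theorem frequently_lt_of_pos {v : E} (hv : 0 < B v v)
    (hg : ∀ᶠ y in 𝓝 y₀, DifferentiableAt ℝ g y) (h0 : fderiv ℝ g y₀ = 0)
    (hB : HasFDerivAt (fderiv ℝ g) B y₀) :
    ∃ᶠ y in 𝓝 y₀, y ≠ y₀ ∧ g y₀ < g y := by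
  have hv0 : v ≠ 0 := by
    rintro rfl
    simp at hv
  have hn := norm_pos_iff.2 hv0
  -- With this constant the coercivity condition holds with equality along the whole ray through
  -- `v`.
  have hc : 0 < B v v / ‖v‖ ^ 2 := by positivity
  have key := eventually_lt_of_coercive_direction hc hg h0 hB
  have ht : Tendsto (fun t : ℝ => t • v) (𝓝[>] 0) (𝓝 0) := by
    have : Continuous fun t : ℝ => t • v := by fun_prop
    simpa using (this.tendsto 0).mono_left nhdsWithin_le_nhds
  have ht' : Tendsto (fun t : ℝ => y₀ + t • v) (𝓝[>] 0) (𝓝 y₀) := by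
    simpa using ht.const_add y₀
  refine ht'.frequently (Eventually.frequently ?_)
  filter_upwards [ht.eventually key, self_mem_nhdsWithin] with t h1 h2
  have h2 : 0 < t := h2
  have h3 : t • v ≠ 0 := smul_ne_zero h2.ne' hv0
  refine ⟨by simpa using h3, h1 h3 (le_of_eq ?_)⟩
  rw [norm_smul]
  simp only [map_smul, smul_apply, smul_eq_mul, Real.norm_eq_abs, mul_pow, sq_abs]
  field_simp

theorem eventually_lt_iff_sigNeg_eq_zero {D : ℕ} {g : EuclideanSpace ℝ (Fin D) → ℝ}
    {y₀ : EuclideanSpace ℝ (Fin D)}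
    {B : EuclideanSpace ℝ (Fin D) →L[ℝ] EuclideanSpace ℝ (Fin D) →L[ℝ] ℝ} (hnd : IsNondeg B)
    (hg : ∀ᶠ y in 𝓝 y₀, DifferentiableAt ℝ g y) (h0 : fderiv ℝ g y₀ = 0)
    (hB : HasFDerivAt (fderiv ℝ g) B y₀) :
    (∀ᶠ y in 𝓝 y₀, y ≠ y₀ → g y₀ < g y) ↔ sigNeg (quadForm B) = 0 := by
  constructor
  · intro h
    by_contra hne
    obtain ⟨v, hv⟩ := exists_neg_of_sigNeg_ne_zero hne
    have hn : HasFDerivAt (fderiv ℝ (-g)) (-B) y₀ := by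
      have : fderiv ℝ (-g) = -fderiv ℝ g := by
        ext1 y
        exact fderiv_neg
      rw [this]
      exact hB.neg
    have := frequently_lt_of_pos (B := -B) (g := -g) (v := v) (by simpa using hv)
      (hg.mono fun y hy => hy.neg) (by rw [fderiv_neg, h0, neg_zero]) hn
    refine this (h.mono fun y hy hy' => ?_)
    have := hy hy'.1
    have := hy'.2
    simp only [Pi.neg_apply] at this
    linarith
  · intro h
    obtain ⟨c, hc, hcB⟩ := hnd.sigNeg_eq_zero_iff.1 h
    exact eventually_lt_of_coercive hc hg h0 hB hcB

theorem eventually_gt_iff_sigNeg_eq {D : ℕ} {g : EuclideanSpace ℝ (Fin D) → ℝ}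
    {y₀ : EuclideanSpace ℝ (Fin D)}
    {B : EuclideanSpace ℝ (Fin D) →L[ℝ] EuclideanSpace ℝ (Fin D) →L[ℝ] ℝ} (hnd : IsNondeg B)
    (hg : ∀ᶠ y in 𝓝 y₀, DifferentiableAt ℝ g y) (h0 : fderiv ℝ g y₀ = 0)
    (hB : HasFDerivAt (fderiv ℝ g) B y₀) :
    (∀ᶠ y in 𝓝 y₀, y ≠ y₀ → g y < g y₀) ↔ sigNeg (quadForm B) = D := by
  have hn : HasFDerivAt (fderiv ℝ (-g)) (-B) y₀ := by
    have : fderiv ℝ (-g) = -fderiv ℝ g := by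
      ext1 y
      exact fderiv_neg
    rw [this]
    exact hB.neg
  have key := eventually_lt_iff_sigNeg_eq_zero hnd.neg (hg.mono fun y hy => hy.neg)
    (by rw [fderiv_neg, h0, neg_zero]) hn
  have h1 := hnd.sigPos_add_sigNeg
  have h2 : sigNeg (quadForm (-B)) = sigPos (quadForm B) := by rw [quadForm_neg, sigNeg_neg]
  have h3 : sigNeg (quadForm (-B)) = 0 ↔ sigNeg (quadForm B) = D := by
    rw [h2]
    constructor <;> intro h <;> omega
  rw [← h3, ← key]
  simp

end Test

/-! ### Persistence of nondegenerate zeros of the differential -/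

variable {D : ℕ}

local notation "𝔼" => EuclideanSpace ℝ (Fin D)

theorem IsNondeg.exists_rightInverse {B : 𝔼 →L[ℝ] 𝔼 →L[ℝ] ℝ} (hB : IsNondeg B) :
    ∃ R : ContinuousLinearMap.NonlinearRightInverse B, 0 < R.nnnorm ∧
      ∀ x, ‖x‖ ≤ R.nnnorm * ‖B x‖ := by
  have hinj : Function.Injective (B : 𝔼 →ₗ[ℝ] 𝔼 →L[ℝ] ℝ) :=
    (injective_iff_map_eq_zero _).2 hB.eq_zero
  have hdim : Module.finrank ℝ 𝔼 = Module.finrank ℝ (𝔼 →L[ℝ] ℝ) :=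
    ((InnerProductSpace.toDual ℝ 𝔼).toLinearEquiv.finrank_eq)
  let L : 𝔼 ≃L[ℝ] (𝔼 →L[ℝ] ℝ) :=
    (LinearEquiv.ofInjectiveOfFinrankEq (B : 𝔼 →ₗ[ℝ] 𝔼 →L[ℝ] ℝ) hinj hdim).toContinuousLinearEquiv
  have hL : ∀ x, L x = B x := fun x => rfl
  have hb : ∀ y, ‖L.symm y‖ ≤ (‖(L.symm : (𝔼 →L[ℝ] ℝ) →L[ℝ] 𝔼)‖₊ + 1 : NNReal) * ‖y‖ := fun y => by
    refine ((L.symm : (𝔼 →L[ℝ] ℝ) →L[ℝ] 𝔼).le_opNorm y).trans ?_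
    gcongr
    simp
  -- The summand `1` keeps the bound positive even for `D = 0`, where the inverse has norm `0`.
  refine ⟨⟨L.symm, ‖(L.symm : (𝔼 →L[ℝ] ℝ) →L[ℝ] 𝔼)‖₊ + 1, hb, fun y => ?_⟩, by positivity, ?_⟩
  · rw [← hL, L.apply_symm_apply]
  · intro x
    have := hb (L x)
    rwa [L.symm_apply_apply] at this

/-- If the differential of `g` has a nondegenerate zero at `y₀`, then the differential of every
`C²`-small perturbation of `g` has exactly one zero near `y₀`, which is nondegenerate of the
same index. -/
theorem exists_unique_zero_fderiv {g : 𝔼 → ℝ} {y₀ : 𝔼} (hg : ContDiffAt ℝ 2 g y₀)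
    (h0 : fderiv ℝ g y₀ = 0) (hB : IsNondeg (fderiv ℝ (fderiv ℝ g) y₀)) :
    ∃ r₀ > 0, ∀ r > 0, r ≤ r₀ → ∃ η > 0, ∀ g' : 𝔼 → ℝ,
      (∀ y ∈ Metric.closedBall y₀ r, ContDiffAt ℝ 2 g' y) →
      (∀ y ∈ Metric.closedBall y₀ r, ‖fderiv ℝ g' y - fderiv ℝ g y‖ ≤ η) →
      (∀ y ∈ Metric.closedBall y₀ r,
        ‖fderiv ℝ (fderiv ℝ g') y - fderiv ℝ (fderiv ℝ g) y‖ ≤ η) →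
      ∃ y' ∈ Metric.ball y₀ r, (∀ y ∈ Metric.closedBall y₀ r, fderiv ℝ g' y = 0 ↔ y = y') ∧
        IsNondeg (fderiv ℝ (fderiv ℝ g') y') ∧
        sigNeg (quadForm (fderiv ℝ (fderiv ℝ g') y')) =
          sigNeg (quadForm (fderiv ℝ (fderiv ℝ g) y₀)) := by
  set B := fderiv ℝ (fderiv ℝ g) y₀ with hBdef
  obtain ⟨κ, hκ, hstable⟩ := hB.exists_stable
  obtain ⟨R, hR, hRb⟩ := hB.exists_rightInverse
  set K : ℝ := (R.nnnorm : ℝ) with hK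
  have hK0 : 0 < K := hR
  -- A Hessian within `c < κ` of `B` keeps its nondegeneracy and index; `c ≤ 1 / (2 * K)` makes the
  -- nonlinear error at most half of what `B` expands.
  let c : NNReal := ⟨min κ (1 / K) / 2, by positivity⟩
  have hc0 : 0 < (c : ℝ) := show 0 < min κ (1 / K) / 2 by positivity
  have hcκ : (c : ℝ) < κ := by
    change min κ (1 / K) / 2 < κ
    linarith [min_le_left κ (1 / K)]
  have hcK : (c : ℝ) ≤ 1 / (2 * K) := by
    change min κ (1 / K) / 2 ≤ _
    rw [show 1 / (2 * K) = 1 / K / 2 by field_simp]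
    linarith [min_le_right κ (1 / K)]
  have hcont : ContinuousAt (fderiv ℝ (fderiv ℝ g)) y₀ :=
    (((hg.fderiv_right (m := 1) (by norm_num)).fderiv_right (m := 0) (by norm_num))).continuousAt
  obtain ⟨r₀, hr₀, hr₀B⟩ := Metric.eventually_nhds_iff_ball.1
    (hcont.eventually (Metric.closedBall_mem_nhds B (half_pos hc0)))
  -- One `c / 2` is spent on the oscillation of the Hessian of `g`, the other on the perturbation.
  -- The bound `r / (4 * K)` on the gradient at `y₀` puts `0` in the ball covered by the image of
  -- the half ball.
  refine ⟨r₀ / 2, half_pos hr₀, fun r hr hrr => ⟨min (c / 2) (r / (4 * K)), by positivity,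
    fun g' hg' h1 h2 => ?_⟩⟩
  have hnear : ∀ y ∈ Metric.closedBall y₀ r, ‖fderiv ℝ (fderiv ℝ g') y - B‖ ≤ c := fun y hy => by
    have e1 := (h2 y hy).trans (min_le_left _ _)
    have e2 := hr₀B y (by
      rw [Metric.mem_ball]
      rw [Metric.mem_closedBall] at hy
      linarith)
    replace e2 : ‖fderiv ℝ (fderiv ℝ g) y - B‖ ≤ c / 2 :=
      (dist_eq_norm (fderiv ℝ (fderiv ℝ g) y) B).symm.trans_le e2
    have := norm_add_le (fderiv ℝ (fderiv ℝ g') y - fderiv ℝ (fderiv ℝ g) y)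
      (fderiv ℝ (fderiv ℝ g) y - B)
    rw [sub_add_sub_cancel] at this
    linarith
  have hdiff : ∀ y ∈ Metric.closedBall y₀ r,
      HasFDerivAt (fderiv ℝ g') (fderiv ℝ (fderiv ℝ g') y) y := fun y hy =>
    (((hg' y hy).fderiv_right (m := 1) (by norm_num)).differentiableAt one_ne_zero).hasFDerivAt
  -- The mean value inequality on the convex ball; this approximation yields both uniqueness and
  -- existence of the zero.
  have happrox : ApproximatesLinearOn (fderiv ℝ g') B (Metric.closedBall y₀ r) c := fun x hx y hy =>
    (convex_closedBall y₀ r).norm_image_sub_le_of_norm_hasFDerivWithin_le'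
      (fun z hz => (hdiff z hz).hasFDerivWithinAt) hnear hy hx
  have hinj : ∀ x ∈ Metric.closedBall y₀ r, ∀ y ∈ Metric.closedBall y₀ r,
      fderiv ℝ g' x = 0 → fderiv ℝ g' y = 0 → x = y := fun x hx y hy hx0 hy0 => by
    have e1 := happrox x hx y hy
    rw [hx0, hy0, sub_zero, zero_sub, norm_neg] at e1
    have e2 := hRb (x - y)
    have e3 : K * ‖B (x - y)‖ ≤ K * (1 / (2 * K) * ‖x - y‖) := by
      refine mul_le_mul_of_nonneg_left (e1.trans ?_) hK0.le
      gcongr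
    have e4 : K * (1 / (2 * K) * ‖x - y‖) = ‖x - y‖ / 2 := by field_simp
    have e5 : ‖x - y‖ ≤ 0 := by linarith
    exact sub_eq_zero.1 (norm_le_zero_iff.1 e5)
  have hsub : Metric.closedBall y₀ (r / 2) ⊆ Metric.closedBall y₀ r :=
    Metric.closedBall_subset_closedBall (by linarith)
  -- Solving in the ball of radius `r / 2` places the zero in the open ball of radius `r`.
  have hsurj := (happrox.mono_set hsub).surjOn_closedBall_of_nonlinearRightInverse R
    (half_pos hr).le subset_rfl
  have hzero : (0 : 𝔼 →L[ℝ] ℝ) ∈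
      Metric.closedBall (fderiv ℝ g' y₀) (((R.nnnorm : ℝ)⁻¹ - c) * (r / 2)) := by
    rw [mem_closedBall_iff_norm, zero_sub, norm_neg]
    have e1 := (h1 y₀ (Metric.mem_closedBall_self hr.le)).trans (min_le_right _ _)
    rw [h0, sub_zero] at e1
    have e2 : r / (4 * K) = (K⁻¹ - 1 / (2 * K)) * (r / 2) := by field_simp; norm_num
    rw [e2] at e1
    refine e1.trans ?_
    gcongr
  obtain ⟨y', hy', hy'0⟩ := hsurj hzero
  have hsymm : ∀ x y, fderiv ℝ (fderiv ℝ g') y' x y = fderiv ℝ (fderiv ℝ g') y' y x := fun x y =>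
    (((hg' y' (hsub hy')).isSymmSndFDerivAt (by simp)) x y)
  have hst := hstable _ hsymm ((hnear y' (hsub hy')).trans_lt hcκ)
  refine ⟨y', ?_, fun y hy => ⟨fun h => hinj y hy y' (hsub hy') h hy'0, fun h => h ▸ hy'0⟩, hst⟩
  rw [Metric.mem_closedBall] at hy'
  rw [Metric.mem_ball]
  linarith

end SecondOrder

section Charts

variable {D : ℕ}

theorem norm_le_norm_toLp (L : EuclideanSpace ℝ (Fin D) →L[ℝ] ℝ) :
    ‖L‖ ≤ ‖(WithLp.toLp 2 fun i => L (EuclideanSpace.single i 1) :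
      EuclideanSpace ℝ (Fin D))‖ := by
  refine L.opNorm_le_bound (norm_nonneg _) fun x => ?_
  refine le_trans (le_of_eq ?_) (norm_inner_le_norm (𝕜 := ℝ) _ x)
  rw [apply_eq_sum, PiLp.inner_apply]
  simp

variable {H : Type*} [TopologicalSpace H]
  {I : ModelWithCorners ℝ (EuclideanSpace ℝ (Fin D)) H}
  {S : Type*} [TopologicalSpace S]
  {e e' : OpenPartialHomeomorph S H} {f f' : S → ℝ} {x : S}

/-! ### Coordinate expressions -/

theorem gradIn_eq_zero_iff {y : EuclideanSpace ℝ (Fin D)} :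
    gradIn I e f y = 0 ↔ fderivWithin ℝ (localRep I e f) (range I) y = 0 := by
  constructor
  · intro h
    refine norm_le_zero_iff.1 ((norm_le_norm_toLp _).trans_eq ?_)
    exact norm_eq_zero.2 h
  · intro h
    rw [gradIn, h]
    rfl

theorem norm_fderivWithin_sub_le (y : EuclideanSpace ℝ (Fin D)) :
    ‖fderivWithin ℝ (localRep I e f') (range I) y - fderivWithin ℝ (localRep I e f) (range I) y‖ ≤
      ‖gradIn I e f' y - gradIn I e f y‖ :=
  norm_le_norm_toLp _

theorem range_mem_nhds {y : EuclideanSpace ℝ (Fin D)}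
    (hy : y ∈ interior (e.extend I).target) : range I ∈ 𝓝 y :=
  mem_of_superset (mem_interior_iff_mem_nhds.1 hy) e.extend_target_subset_range

theorem localRep_eventuallyEq (hx : x ∈ e.source) (hx' : x ∈ e'.source) :
    localRep I e f =ᶠ[𝓝[range I] e.extend I x] localRep I e' f ∘ I.extendCoordChange e e' := by
  filter_upwards [I.extendCoordChange_source_mem_nhdsWithin' hx hx'] with y hy
  have : (e.extend I).symm y ∈ (e'.extend I).source := hy.2
  simp [localRep, (e'.extend I).left_inv this, -OpenPartialHomeomorph.extend]

theorem extendCoordChange_extend (hx : x ∈ e.source) :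
    I.extendCoordChange e e' (e.extend I x) = e'.extend I x := by
  change e'.extend I ((e.extend I).symm (e.extend I x)) = _
  rw [e.extend_left_inv hx]

theorem fderivWithin_localRep_eq_fderiv {y : EuclideanSpace ℝ (Fin D)}
    (hy : y ∈ interior (e.extend I).target) :
    fderivWithin ℝ (localRep I e f) (range I) y = fderiv ℝ (localRep I e f) y :=
  fderivWithin_of_mem_nhds (range_mem_nhds hy)

theorem hessIn_eq_gram {y : EuclideanSpace ℝ (Fin D)} (hy : y ∈ interior (e.extend I).target) :
    hessIn I e f y = gram (fderiv ℝ (fderiv ℝ (localRep I e f)) y) := by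
  ext i j
  rw [hessIn, gram, Matrix.of_apply, Matrix.of_apply,
    iteratedFDerivWithin_two_apply _ I.uniqueDiffOn (mem_of_mem_nhds (range_mem_nhds hy)),
    fderivWithin_fderivWithin_eq_of_mem_nhds (range_mem_nhds hy)]
  rfl

/-! ### Regularity of coordinate expressions -/

variable [ChartedSpace H S]

theorem contDiffOn_localRep (he : e ∈ IsManifold.maximalAtlas I 2 S)
    (hf : ContMDiff I 𝓘(ℝ, ℝ) 2 f) : ContDiffOn ℝ 2 (localRep I e f) (e.extend I).target := by
  rw [e.extend_target']
  exact contMDiffOn_iff_contDiffOn.1 (hf.comp_contMDiffOn (contMDiffOn_extend_symm he))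

theorem contDiffWithinAt_localRep (he : e ∈ IsManifold.maximalAtlas I 2 S)
    (hf : ContMDiff I 𝓘(ℝ, ℝ) 2 f) (hx : x ∈ e.source) :
    ContDiffWithinAt ℝ 2 (localRep I e f) (range I) (e.extend I x) :=
  (contDiffOn_localRep he hf _ ((e.extend I).map_source (by rwa [e.extend_source]))
    ).mono_of_mem_nhdsWithin (e.extend_target_mem_nhdsWithin hx)

theorem contDiffAt_localRep (he : e ∈ IsManifold.maximalAtlas I 2 S)
    (hf : ContMDiff I 𝓘(ℝ, ℝ) 2 f) {y : EuclideanSpace ℝ (Fin D)}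
    (hy : y ∈ interior (e.extend I).target) : ContDiffAt ℝ 2 (localRep I e f) y :=
  (contDiffOn_localRep he hf).contDiffAt (mem_interior_iff_mem_nhds.1 hy)

theorem fderiv_fderiv_localRep_symm (he : e ∈ IsManifold.maximalAtlas I 2 S)
    (hf : ContMDiff I 𝓘(ℝ, ℝ) 2 f) {y : EuclideanSpace ℝ (Fin D)}
    (hy : y ∈ interior (e.extend I).target) (u v : EuclideanSpace ℝ (Fin D)) :
    fderiv ℝ (fderiv ℝ (localRep I e f)) y u v = fderiv ℝ (fderiv ℝ (localRep I e f)) y v u :=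
  ((contDiffAt_localRep he hf hy).isSymmSndFDerivAt (by simp)) u v

theorem continuousOn_gradIn (he : e ∈ IsManifold.maximalAtlas I 2 S)
    (hf : ContMDiff I 𝓘(ℝ, ℝ) 2 f) :
    ContinuousOn (fun x => gradIn I e f (e.extend I x)) e.source := by
  have h1 : ContinuousOn (fderivWithin ℝ (localRep I e f) (range I)) (e.extend I).target := by
    intro y hy
    rw [e.extend_target_eq_image_source] at hy
    obtain ⟨x, hx, rfl⟩ := hy
    exact ((contDiffWithinAt_localRep he hf hx).fderivWithin_right (m := 1) I.uniqueDiffOn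
      (by norm_num) (mem_range_self _)).continuousWithinAt.mono e.extend_target_subset_range
  have h2 : ContinuousOn (fun x => fderivWithin ℝ (localRep I e f) (range I) (e.extend I x))
      e.source :=
    h1.comp (by rw [← e.extend_source (I := I)]; exact e.continuousOn_extend) fun x hx =>
      (e.extend I).map_source (by rwa [e.extend_source])
  unfold gradIn
  refine (PiLp.continuous_toLp 2 _).comp_continuousOn (continuousOn_pi.2 fun i => ?_)
  exact h2.clm_apply continuousOn_const

/-! ### Change of charts -/

theorem fderivWithin_localRep_eq_comp (he : e ∈ IsManifold.maximalAtlas I 2 S)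
    (he' : e' ∈ IsManifold.maximalAtlas I 2 S) (hf : ContMDiff I 𝓘(ℝ, ℝ) 2 f)
    (hx : x ∈ e.source) (hx' : x ∈ e'.source) :
    fderivWithin ℝ (localRep I e f) (range I) (e.extend I x) =
      (fderivWithin ℝ (localRep I e' f) (range I) (e'.extend I x)).comp
        (fderivWithin ℝ (I.extendCoordChange e e') (range I) (e.extend I x)) := by
  have hmem : e.extend I x ∈ range I := mem_range_self _
  rw [(localRep_eventuallyEq hx hx').fderivWithin_eq
    ((localRep_eventuallyEq hx hx').self_of_nhdsWithin hmem)]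
  rw [fderivWithin_comp (t := range I), extendCoordChange_extend hx]
  · rw [extendCoordChange_extend hx]
    exact (contDiffWithinAt_localRep he' hf hx').differentiableWithinAt (by norm_num)
  · exact (I.contDiffWithinAt_extendCoordChange' he he' hx hx').differentiableWithinAt
      (by norm_num)
  · exact fun y _ => mem_range_self _
  · exact I.uniqueDiffOn _ hmem

theorem fderivWithin_localRep_eq_zero (he : e ∈ IsManifold.maximalAtlas I 2 S)
    (he' : e' ∈ IsManifold.maximalAtlas I 2 S) (hf : ContMDiff I 𝓘(ℝ, ℝ) 2 f)
    (hx : x ∈ e.source) (hx' : x ∈ e'.source)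
    (h : fderivWithin ℝ (localRep I e' f) (range I) (e'.extend I x) = 0) :
    fderivWithin ℝ (localRep I e f) (range I) (e.extend I x) = 0 := by
  rw [fderivWithin_localRep_eq_comp he he' hf hx hx', h, ContinuousLinearMap.zero_comp]

theorem isCrit_iff_chartAt (hf : ContMDiff I 𝓘(ℝ, ℝ) 2 f) :
    IsCrit I f x ↔
      fderivWithin ℝ (localRep I (chartAt H x) f) (range I) ((chartAt H x).extend I x) = 0 := by
  rw [IsCrit, (hf.mdifferentiable (by norm_num) x).mfderiv]
  rfl

theorem isCrit_iff [IsManifold I 2 S] (he : e ∈ IsManifold.maximalAtlas I 2 S)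
    (hf : ContMDiff I 𝓘(ℝ, ℝ) 2 f) (hx : x ∈ e.source) :
    IsCrit I f x ↔ fderivWithin ℝ (localRep I e f) (range I) (e.extend I x) = 0 := by
  rw [isCrit_iff_chartAt hf]
  have h := IsManifold.chart_mem_maximalAtlas (I := I) (n := 2) x
  exact ⟨fderivWithin_localRep_eq_zero he h hf hx (mem_chart_source H x),
    fderivWithin_localRep_eq_zero h he hf (mem_chart_source H x) hx⟩

/-- In the second-order chain rule the term with the second derivative of the coordinate change is
multiplied by the first derivative of `f`, which vanishes at a critical point. What remains is
congruence by the invertible derivative of the coordinate change. -/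
theorem exists_congr_fderiv_fderiv (he : e ∈ IsManifold.maximalAtlas I 2 S)
    (he' : e' ∈ IsManifold.maximalAtlas I 2 S) (hf : ContMDiff I 𝓘(ℝ, ℝ) 2 f)
    (hx : x ∈ e.source) (hx' : x ∈ e'.source)
    (hi : e.extend I x ∈ interior (e.extend I).target)
    (hi' : e'.extend I x ∈ interior (e'.extend I).target)
    (h0 : fderiv ℝ (localRep I e' f) (e'.extend I x) = 0) :
    ∃ T : EuclideanSpace ℝ (Fin D) ≃L[ℝ] EuclideanSpace ℝ (Fin D), ∀ u v,
      fderiv ℝ (fderiv ℝ (localRep I e f)) (e.extend I x) u v =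
        fderiv ℝ (fderiv ℝ (localRep I e' f)) (e'.extend I x) (T u) (T v) := by
  set φ := I.extendCoordChange e e' with hφ
  set y₀ := e.extend I x with hy₀
  have hR : range I ∈ 𝓝 y₀ := range_mem_nhds hi
  have hφy : φ y₀ = e'.extend I x := extendCoordChange_extend hx
  have hsrc : φ.source ∈ 𝓝 y₀ := by
    have := I.extendCoordChange_source_mem_nhdsWithin' hx hx'
    rwa [nhdsWithin_eq_nhds.2 hR] at this
  have hφc : ContDiffAt ℝ 2 φ y₀ :=
    (I.contDiffOn_extendCoordChange he he').contDiffAt hsrc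
  have hg' : ContDiffAt ℝ 2 (localRep I e' f) (φ y₀) := by
    rw [hφy]; exact contDiffAt_localRep he' hf hi'
  have hev : fderiv ℝ (localRep I e f) =ᶠ[𝓝 y₀]
      fun y => (fderiv ℝ (localRep I e' f) (φ y)).comp (fderiv ℝ φ y) := by
    have h1 : localRep I e f =ᶠ[𝓝 y₀] localRep I e' f ∘ φ := by
      have := localRep_eventuallyEq (I := I) (f := f) hx hx'
      rwa [nhdsWithin_eq_nhds.2 hR] at this
    have h2 : ∀ᶠ y in 𝓝 y₀, ContDiffAt ℝ 2 (localRep I e' f) (φ y) :=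
      hφc.continuousAt.eventually (hg'.eventually (by simp))
    filter_upwards [h1.eventuallyEq_nhds, h2, hφc.eventually (by simp)] with y k1 k2 k3
    rw [k1.fderiv_eq]
    exact fderiv_comp y (k2.differentiableAt (by norm_num)) (k3.differentiableAt (by norm_num))
  have hc : HasFDerivAt (fun y => fderiv ℝ (localRep I e' f) (φ y))
      ((fderiv ℝ (fderiv ℝ (localRep I e' f)) (φ y₀)).comp (fderiv ℝ φ y₀)) y₀ :=
    (((hg'.fderiv_right (m := 1) (by norm_num)).differentiableAt one_ne_zero).hasFDerivAt).comp y₀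
      (hφc.differentiableAt (by norm_num)).hasFDerivAt
  have hd : HasFDerivAt (fderiv ℝ φ) (fderiv ℝ (fderiv ℝ φ) y₀) y₀ :=
    ((hφc.fderiv_right (m := 1) (by norm_num)).differentiableAt one_ne_zero).hasFDerivAt
  have hinv := I.isInvertible_fderivWithin_extendCoordChange (n := 2) (by norm_num) he he'
    (x := y₀) (mem_of_mem_nhds hsrc)
  rw [fderivWithin_of_mem_nhds hsrc] at hinv
  obtain ⟨T, hT⟩ := hinv
  refine ⟨T, fun u v => ?_⟩
  rw [hev.fderiv_eq, (hc.clm_comp hd).fderiv, hφy, h0]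
  have hT' : ∀ w, T w = fderiv ℝ φ y₀ w := fun w => by
    rw [← hφ] at hT
    exact congrArg (fun L => L w) hT
  simp [hT']

end Charts

section CriticalPoints

variable {D : ℕ} {H : Type*} [TopologicalSpace H]
  {I : ModelWithCorners ℝ (EuclideanSpace ℝ (Fin D)) H}
  {S : Type*} [TopologicalSpace S] [ChartedSpace H S]
  {f : S → ℝ} {x p q : S}

/-! ### Nondegenerate interior critical points -/

variable (I) in
/-- The second derivative of the coordinate expression of `f` in the preferred chart at `q`. -/
def hessForm (q : S) (f : S → ℝ) (x : S) :
    EuclideanSpace ℝ (Fin D) →L[ℝ] EuclideanSpace ℝ (Fin D) →L[ℝ] ℝ :=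
  fderiv ℝ (fderiv ℝ (localRep I (chartAt H q) f)) ((chartAt H q).extend I x)

variable (I) in
/-- An interior critical point with invertible Hessian. -/
structure IsInteriorMorsePoint (f : S → ℝ) (p : S) : Prop where
  isCrit : IsCrit I f p
  isInteriorPoint : I.IsInteriorPoint p
  det_ne_zero : (hess I f p).det ≠ 0

theorem extend_self_mem_interior (h : I.IsInteriorPoint p) :
    (chartAt H p).extend I p ∈ interior ((chartAt H p).extend I).target :=
  ModelWithCorners.isInteriorPoint_iff.1 h

theorem hess_eq_gram (h : I.IsInteriorPoint p) : hess I f p = gram (hessForm I p f p) :=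
  hessIn_eq_gram (extend_self_mem_interior h)

variable [IsManifold I 2 S]

theorem chart_mem (q : S) : chartAt H q ∈ IsManifold.maximalAtlas I 2 S :=
  IsManifold.chart_mem_maximalAtlas q

theorem extend_mem_interior_iff (hx : x ∈ (chartAt H q).source) :
    (chartAt H q).extend I x ∈ interior ((chartAt H q).extend I).target ↔ I.IsInteriorPoint x :=
  (I.isInteriorPoint_iff_of_mem_atlas (n := 2) (by norm_num) (chart_mem_atlas H q) hx).symm

theorem isCrit_iff_fderiv (hf : ContMDiff I 𝓘(ℝ, ℝ) 2 f) (hx : x ∈ (chartAt H q).source)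
    (hi : I.IsInteriorPoint x) :
    IsCrit I f x ↔ fderiv ℝ (localRep I (chartAt H q) f) ((chartAt H q).extend I x) = 0 := by
  rw [isCrit_iff (chart_mem q) hf hx,
    fderivWithin_localRep_eq_fderiv ((extend_mem_interior_iff hx).2 hi)]

theorem hessForm_symm (hf : ContMDiff I 𝓘(ℝ, ℝ) 2 f) (hx : x ∈ (chartAt H q).source)
    (hi : I.IsInteriorPoint x) (u v : EuclideanSpace ℝ (Fin D)) :
    hessForm I q f x u v = hessForm I q f x v u :=
  fderiv_fderiv_localRep_symm (chart_mem q) hf ((extend_mem_interior_iff hx).2 hi) u v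

theorem IsInteriorMorsePoint.isNondeg_self (hf : ContMDiff I 𝓘(ℝ, ℝ) 2 f)
    (h : IsInteriorMorsePoint I f p) : IsNondeg (hessForm I p f p) := by
  rw [isNondeg_iff_det (hessForm_symm hf (mem_chart_source H p) h.isInteriorPoint),
    ← hess_eq_gram h.isInteriorPoint]
  exact h.det_ne_zero

theorem morseIndex_eq_self (hf : ContMDiff I 𝓘(ℝ, ℝ) 2 f) (h : I.IsInteriorPoint p) :
    morseIndex I f p = sigNeg (quadForm (hessForm I p f p)) := by
  classical
  rw [← countP_roots_charpoly_gram (hessForm_symm hf (mem_chart_source H p) h), morseIndex,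
    hess_eq_gram h]

/-- Perturbing `f` moves the critical point and so changes its preferred chart. This lemma and the
next allow the index and nondegeneracy to be compared in one fixed chart. -/
theorem IsInteriorMorsePoint.isNondeg (hf : ContMDiff I 𝓘(ℝ, ℝ) 2 f)
    (h : IsInteriorMorsePoint I f p) (hp : p ∈ (chartAt H q).source) :
    IsNondeg (hessForm I q f p) ∧
      sigNeg (quadForm (hessForm I q f p)) = morseIndex I f p := by
  have hp' := mem_chart_source H p
  obtain ⟨T, hT⟩ := exists_congr_fderiv_fderiv (chart_mem q) (chart_mem p) hf hp hp'
    ((extend_mem_interior_iff hp).2 h.isInteriorPoint)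
    (extend_self_mem_interior h.isInteriorPoint)
    ((isCrit_iff_fderiv hf hp' h.isInteriorPoint).1 h.isCrit)
  rw [morseIndex_eq_self hf h.isInteriorPoint]
  exact (h.isNondeg_self hf).congr T hT

theorem IsInteriorMorsePoint.of_isNondeg (hf : ContMDiff I 𝓘(ℝ, ℝ) 2 f)
    (hc : IsCrit I f p) (hi : I.IsInteriorPoint p) (hp : p ∈ (chartAt H q).source)
    (h : IsNondeg (hessForm I q f p)) : IsInteriorMorsePoint I f p := by
  have hp' := mem_chart_source H p
  obtain ⟨T, hT⟩ := exists_congr_fderiv_fderiv (chart_mem p) (chart_mem q) hf hp' hp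
    (extend_self_mem_interior hi) ((extend_mem_interior_iff hp).2 hi)
    ((isCrit_iff_fderiv hf hp hi).1 hc)
  refine ⟨hc, hi, ?_⟩
  rw [hess_eq_gram hi, ← isNondeg_iff_det (hessForm_symm hf hp' hi)]
  exact (h.congr T hT).1

/-! ### Extrema, saddles and undulation points among nondegenerate critical points -/

omit [IsManifold I 2 S] in
theorem eventually_nhdsNE_iff_localRep (h : I.IsInteriorPoint p) (r : ℝ → ℝ → Prop) :
    (∀ᶠ x in 𝓝[≠] p, r (f p) (f x)) ↔
      ∀ᶠ y in 𝓝 ((chartAt H p).extend I p), y ≠ (chartAt H p).extend I p →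
        r (localRep I (chartAt H p) f ((chartAt H p).extend I p))
          (localRep I (chartAt H p) f y) := by
  have hp := mem_chart_source H p
  have hsub := (chartAt H p).extend_target_subset_range (I := I)
  rw [← (chartAt H p).map_extend_nhds_of_mem_interior_range hp
    (interior_mono hsub (extend_self_mem_interior h)), eventually_map, eventually_nhdsWithin_iff]
  have hloc : ∀ x ∈ (chartAt H p).source,
      localRep I (chartAt H p) f ((chartAt H p).extend I x) = f x := fun x hx => by
    rw [localRep, Function.comp_apply, (chartAt H p).extend_left_inv hx]
  refine eventually_congr ?_
  filter_upwards [(chartAt H p).open_source.mem_nhds hp] with x hx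
  rw [hloc x hx, hloc p hp]
  have : (chartAt H p).extend I x ≠ (chartAt H p).extend I p ↔ x ∈ ({p} : Set S)ᶜ := by
    refine not_congr ⟨fun h => ?_, fun h => by rw [mem_singleton_iff.1 h]⟩
    exact ((chartAt H p).extend I).injOn (by rwa [(chartAt H p).extend_source])
      (by rwa [(chartAt H p).extend_source]) h
  rw [this]

section

variable (hf : ContMDiff I 𝓘(ℝ, ℝ) 2 f) (h : IsInteriorMorsePoint I f p)
include hf h

theorem IsInteriorMorsePoint.localRep_facts :
    (∀ᶠ y in 𝓝 ((chartAt H p).extend I p), DifferentiableAt ℝ (localRep I (chartAt H p) f) y) ∧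
      fderiv ℝ (localRep I (chartAt H p) f) ((chartAt H p).extend I p) = 0 ∧
      HasFDerivAt (fderiv ℝ (localRep I (chartAt H p) f)) (hessForm I p f p)
        ((chartAt H p).extend I p) := by
  have hc := contDiffAt_localRep (chart_mem p) hf (extend_self_mem_interior h.isInteriorPoint)
  refine ⟨?_, (isCrit_iff_fderiv hf (mem_chart_source H p) h.isInteriorPoint).1 h.isCrit, ?_⟩
  · filter_upwards [hc.eventually (by simp)] with y hy
    exact hy.differentiableAt (by norm_num)
  · exact ((hc.fderiv_right (m := 1) (by norm_num)).differentiableAt one_ne_zero).hasFDerivAt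

theorem IsInteriorMorsePoint.isStrictLocMin_iff :
    IsStrictLocMin f p ↔ morseIndex I f p = 0 := by
  obtain ⟨h1, h2, h3⟩ := h.localRep_facts hf
  rw [morseIndex_eq_self hf h.isInteriorPoint,
    ← eventually_lt_iff_sigNeg_eq_zero (h.isNondeg_self hf) h1 h2 h3]
  exact eventually_nhdsNE_iff_localRep h.isInteriorPoint fun a b => a < b

theorem IsInteriorMorsePoint.isStrictLocMax_iff :
    IsStrictLocMax f p ↔ morseIndex I f p = D := by
  obtain ⟨h1, h2, h3⟩ := h.localRep_facts hf
  rw [morseIndex_eq_self hf h.isInteriorPoint,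
    ← eventually_gt_iff_sigNeg_eq (h.isNondeg_self hf) h1 h2 h3]
  exact eventually_nhdsNE_iff_localRep h.isInteriorPoint fun a b => b < a

end

omit [IsManifold I 2 S] in
-- Here `w = 0` is itself a regular value with the single preimage `p`, so the degree is the sign of
-- a nonzero determinant.
theorem not_isUndulation_of_det_ne_zero (h : (hess I f p).det ≠ 0) : ¬ IsUndulation I f p := by
  rintro ⟨-, ε, hε, -, hz, δ, hδ, hdeg⟩
  have hset : {y ∈ Metric.ball (extChartAt I p p) ε | gradIn I (chartAt H p) f y = 0} =
      {extChartAt I p p} := by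
    ext y
    constructor
    · rintro ⟨hy, hy0⟩
      exact (hz y (Metric.ball_subset_closedBall hy)).1 hy0
    · rintro rfl
      exact ⟨Metric.mem_ball_self hε, (hz _ (Metric.mem_closedBall_self hε.le)).2 rfl⟩
  have := hdeg 0 (by simpa using hδ) fun y hy hy0 => by
    rw [(hz y (Metric.ball_subset_closedBall hy)).1 hy0]
    exact h
  rw [hset, finsum_mem_singleton] at this
  have hs : SignType.sign (hessIn I (chartAt H p) f (extChartAt I p p)).det = 0 := by
    revert this
    generalize SignType.sign (hessIn I (chartAt H p) f (extChartAt I p p)).det = s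
    cases s <;> simp
  exact h (sign_eq_zero_iff.1 hs)

end CriticalPoints

section Jets

variable {D : ℕ} {H : Type*} [TopologicalSpace H]
  (I : ModelWithCorners ℝ (EuclideanSpace ℝ (Fin D)) H)
  {S : Type*} [TopologicalSpace S] [ChartedSpace H S]

/-! ### Jets on finitely many compact pieces -/

/-- The gradient and the Hessian of `f` on the pieces `K q`, `q ∈ t`, in the preferred chart
at `q`. -/
def compactJet (t : Finset S) (K : S → Set S) (f : C^2⟮I, S; ℝ⟯) (q : t) :
    K q →ᵤ (EuclideanSpace ℝ (Fin D) × (Fin D → Fin D → ℝ)) :=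
  UniformFun.ofFun fun x =>
    (gradIn I (chartAt H q.1) f ((chartAt H q.1).extend I x),
      hessIn I (chartAt H q.1) f ((chartAt H q.1).extend I x))

/-- The `C²`-neighbourhoods of `f` defined by uniform closeness on the pieces `K q`, `q ∈ t`. -/
def jetNhds (t : Finset S) (K : S → Set S) (f : C^2⟮I, S; ℝ⟯) : Filter C^2⟮I, S; ℝ⟯ :=
  comap (compactJet I t K) (𝓝 (compactJet I t K f))

variable {I} {t : Finset S} {K : S → Set S} {f : C^2⟮I, S; ℝ⟯} {p q : S}

/-- The target is a finite product of spaces of functions with a uniform metric, hence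
pseudometrizable; this supplies the coarser topology needed for the Lipschitz minorants. -/
theorem continuous_compactJet [IsManifold I 2 S]
    (hK : ∀ q, IsCompact (K q) ∧ K q ⊆ (chartAt H q).source) : Continuous (compactJet I t K) := by
  refine continuous_pi fun q => ?_
  let e : IsManifold.maximalAtlas I 2 S := ⟨chartAt H q.1, chart_mem q.1⟩
  have h0 : Continuous (jet I : C^2⟮I, S; ℝ⟯ → JetSpace I S) := continuous_induced_dom
  have h1 : Continuous fun f : C^2⟮I, S; ℝ⟯ => jet I f e :=
    (continuous_apply e).comp h0
  have h2 := (UniformOnFun.uniformContinuous_restrict S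
    (ℝ × EuclideanSpace ℝ (Fin D) × Matrix (Fin D) (Fin D) ℝ)
    {K : Set S | IsCompact K ∧ K ⊆ e.1.source} (s := K q.1) (hK q.1)).continuous
  have hπ : UniformContinuous
      (fun z : ℝ × EuclideanSpace ℝ (Fin D) × (Fin D → Fin D → ℝ) => z.2) :=
    uniformContinuous_snd
  have h3 := (UniformFun.postcomp_uniformContinuous (α := K q.1) hπ).continuous
  exact h3.comp (h2.comp h1)

theorem eventually_jetNhds_close (f : C^2⟮I, S; ℝ⟯) {η : ℝ} (hη : 0 < η) :
    ∀ᶠ f' : C^2⟮I, S; ℝ⟯ in jetNhds I t K f, ∀ q ∈ t, ∀ x ∈ K q,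
      ‖gradIn I (chartAt H q) f' ((chartAt H q).extend I x) -
        gradIn I (chartAt H q) f ((chartAt H q).extend I x)‖ < η ∧
      ∀ i j, |hessIn I (chartAt H q) f' ((chartAt H q).extend I x) i j -
        hessIn I (chartAt H q) f ((chartAt H q).extend I x) i j| < η := by
  have h := (Metric.eball_mem_nhds (compactJet I t K f) (ENNReal.ofReal_pos.2 hη))
  filter_upwards [preimage_mem_comap h] with f' hf' q hq x hx
  have h1 : edist (compactJet I t K f') (compactJet I t K f) < ENNReal.ofReal η := hf'
  have h2 := (edist_le_pi_edist _ _ (⟨q, hq⟩ : t)).trans_lt h1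
  have h3 := (UniformFun.edist_eval_le (x := (⟨x, hx⟩ : K q))).trans_lt h2
  have h4 := edist_lt_ofReal.1 h3
  rw [Prod.dist_eq, max_lt_iff] at h4
  refine ⟨(dist_eq_norm _ _).symm.trans_lt h4.1, fun i j => ?_⟩
  have h5 : ∀ a b : Fin D → Fin D → ℝ, |a i j - b i j| ≤ dist a b := fun a b =>
    (Real.dist_eq _ _).symm.trans_le
      ((dist_le_pi_dist (a i) (b i) j).trans (dist_le_pi_dist a b i))
  exact (h5 _ _).trans_lt h4.2

theorem pure_le_jetNhds (f : C^2⟮I, S; ℝ⟯) : pure f ≤ jetNhds I t K f := by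
  rw [jetNhds, ← map_le_iff_le_comap, map_pure]
  exact pure_le_nhds _

variable [IsManifold I 2 S]

/-! ### Persistence of nondegenerate critical points -/

/-- This is `exists_unique_zero_fderiv` read in the chart at `q`, with `N` the preimage of a
coordinate ball so small that it stays over `K q` and inside `W`. -/
theorem exists_isOpen_eventually_unique_crit (hKq : K q ⊆ (chartAt H q).source) (hq : q ∈ t)
    (hp : p ∈ interior (K q)) (h : IsInteriorMorsePoint I f p) {W : Set S} (hW : W ∈ 𝓝 p) :
    ∃ N, IsOpen N ∧ p ∈ N ∧ N ⊆ W ∧ ∀ᶠ f' : C^2⟮I, S; ℝ⟯ in jetNhds I t K f,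
      ∃ p' ∈ N, (∀ x ∈ N, IsCrit I f' x ↔ x = p') ∧ IsInteriorMorsePoint I f' p' ∧
        morseIndex I f' p' = morseIndex I f p := by
  have hps : p ∈ (chartAt H q).source := hKq (interior_subset hp)
  set e := chartAt H q with he
  set y₀ := e.extend I p with hy₀
  have hem : e ∈ IsManifold.maximalAtlas I 2 S := chart_mem q
  have hyi : y₀ ∈ interior (e.extend I).target := (extend_mem_interior_iff hps).2 h.isInteriorPoint
  obtain ⟨hnd, hidx⟩ := h.isNondeg f.contMDiff hps
  obtain ⟨r₀, hr₀, hr₀'⟩ := exists_unique_zero_fderiv (contDiffAt_localRep hem f.contMDiff hyi)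
    ((isCrit_iff_fderiv f.contMDiff hps h.isInteriorPoint).1 h.isCrit) hnd
  have hV : interior (e.extend I).target ∩ (e.extend I).symm ⁻¹' (interior (K q) ∩ W) ∈ 𝓝 y₀ := by
    refine inter_mem (isOpen_interior.mem_nhds hyi) ((e.continuousAt_extend_symm hps) ?_)
    rw [e.extend_left_inv hps]
    exact inter_mem (isOpen_interior.mem_nhds hp) hW
  obtain ⟨R, hR, hRV⟩ := Metric.nhds_basis_closedBall.mem_iff.1 hV
  obtain ⟨η, hη, key⟩ := hr₀' (min R r₀) (lt_min hR hr₀) (min_le_right _ _)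
  set r := min R r₀ with hr
  have hr0 : 0 < r := lt_min hR hr₀
  have hball : ∀ y ∈ Metric.closedBall y₀ r, y ∈ interior (e.extend I).target ∧
      (e.extend I).symm y ∈ K q ∧ (e.extend I).symm y ∈ W ∧
      e.extend I ((e.extend I).symm y) = y := fun y hy => by
    have := hRV (Metric.closedBall_subset_closedBall (min_le_left _ _) hy)
    exact ⟨this.1, interior_subset this.2.1, this.2.2,
      (e.extend I).right_inv (interior_subset this.1)⟩
  have hNball : ∀ x ∈ e.source ∩ e.extend I ⁻¹' Metric.ball y₀ r,
      e.extend I x ∈ Metric.closedBall y₀ r := fun x hx => Metric.ball_subset_closedBall hx.2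
  refine ⟨e.source ∩ e.extend I ⁻¹' Metric.ball y₀ r, e.isOpen_extend_preimage Metric.isOpen_ball,
    ⟨hps, Metric.mem_ball_self hr0⟩, fun x hx => ?_, ?_⟩
  · have := (hball _ (hNball x hx)).2.2.1
    rwa [e.extend_left_inv hx.1] at this
  -- Entrywise bounds on the Hessian cost a factor `D * D` in operator norm; the `+ 1` avoids
  -- division by zero when `D = 0`.
  have hη' : 0 < η / (D * D + 1) := by positivity
  filter_upwards [eventually_jetNhds_close (t := t) (K := K) f (lt_min hη hη')] with f' hf'
  obtain ⟨y', hy', huniq, hnd', hidx'⟩ := key (localRep I e f')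
    (fun y hy => contDiffAt_localRep hem f'.contMDiff (hball y hy).1)
    (fun y hy => by
      obtain ⟨k1, k2, -, k4⟩ := hball y hy
      have := (hf' q hq _ k2).1
      rw [← he, k4] at this
      rw [← fderivWithin_localRep_eq_fderiv k1, ← fderivWithin_localRep_eq_fderiv k1]
      exact ((norm_fderivWithin_sub_le y).trans_lt this).le.trans (min_le_left _ _))
    (fun y hy => by
      obtain ⟨k1, k2, -, k4⟩ := hball y hy
      have := (hf' q hq _ k2).2
      rw [← he, k4, hessIn_eq_gram k1, hessIn_eq_gram k1] at this
      refine (norm_le_of_gram hη'.le fun i j => ?_).trans ?_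
      · rw [gram_sub_apply]
        exact (this i j).le.trans (min_le_right _ _)
      have h1 : (D * D : ℝ) * (η / (D * D + 1)) = (D * D / (D * D + 1)) * η := by ring
      rw [h1]
      refine mul_le_of_le_one_left hη.le ((div_le_one (by positivity)).2 (by linarith)))
  have hy'c := Metric.ball_subset_closedBall hy'
  obtain ⟨k1, k2, -, k4⟩ := hball y' hy'c
  have hN' : (e.extend I).symm y' ∈ e.source ∩ e.extend I ⁻¹' Metric.ball y₀ r := by
    refine ⟨hKq k2, ?_⟩
    rw [mem_preimage, k4]
    exact hy'
  have hint : ∀ x ∈ e.source ∩ e.extend I ⁻¹' Metric.ball y₀ r, I.IsInteriorPoint x := fun x hx =>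
    (extend_mem_interior_iff hx.1).1 (hball _ (hNball x hx)).1
  have hcrit : ∀ x ∈ e.source ∩ e.extend I ⁻¹' Metric.ball y₀ r,
      (IsCrit I f' x ↔ x = (e.extend I).symm y') := fun x hx => by
    rw [isCrit_iff_fderiv f'.contMDiff hx.1 (hint x hx), huniq _ (hNball x hx)]
    constructor
    · intro h
      rw [← h, e.extend_left_inv hx.1]
    · rintro rfl
      exact k4
  have hnd'' : IsNondeg (hessForm I q f' ((e.extend I).symm y')) := by
    rw [hessForm, ← he, k4]
    exact hnd'
  have hM := IsInteriorMorsePoint.of_isNondeg f'.contMDiff ((hcrit _ hN').2 rfl) (hint _ hN') hN'.1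
    hnd''
  refine ⟨_, hN', hcrit, hM, ?_⟩
  rw [← (hM.isNondeg f'.contMDiff hN'.1).2, ← hidx, hessForm, ← he, k4]
  exact hidx'

/-- On each of the finitely many compact sets `A ∩ K q` the gradient norm has a positive lower
bound, and a smaller perturbation cannot produce a zero. -/
theorem eventually_forall_not_isCrit (hK : ∀ q, IsCompact (K q) ∧ K q ⊆ (chartAt H q).source)
    (hcov : ∀ x, ∃ q ∈ t, x ∈ interior (K q)) {A : Set S} (hA : IsClosed A)
    (hf : ∀ x ∈ A, ¬ IsCrit I f x) :
    ∀ᶠ f' : C^2⟮I, S; ℝ⟯ in jetNhds I t K f, ∀ x ∈ A, ¬ IsCrit I f' x := by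
  have hgrad : ∀ (f : C^2⟮I, S; ℝ⟯) (q x : S), x ∈ K q →
      (IsCrit I f x ↔ gradIn I (chartAt H q) f ((chartAt H q).extend I x) = 0) := fun f q x hx => by
    rw [gradIn_eq_zero_iff, isCrit_iff (chart_mem q) f.contMDiff ((hK q).2 hx)]
  have hq : ∀ q ∈ t, ∀ᶠ f' : C^2⟮I, S; ℝ⟯ in jetNhds I t K f, ∀ x ∈ A ∩ K q, ¬ IsCrit I f' x := by
    intro q hq
    have hcont : ContinuousOn
        (fun x => ‖gradIn I (chartAt H q) f ((chartAt H q).extend I x)‖) (A ∩ K q) :=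
      ((continuousOn_gradIn (chart_mem q) f.contMDiff).mono
        (inter_subset_right.trans (hK q).2)).norm
    obtain ⟨δ, hδ, hmin⟩ := ((hK q).1.inter_left hA).exists_forall_le' hcont (a := 0)
      fun x hx => norm_pos_iff.2 fun h => hf x hx.1 ((hgrad f q x hx.2).2 h)
    filter_upwards [eventually_jetNhds_close (t := t) (K := K) f hδ] with f' hf' x hx hc
    have h1 := (hf' q hq x hx.2).1
    rw [(hgrad f' q x hx.2).1 hc, zero_sub, norm_neg] at h1
    exact (h1.trans_le (hmin x hx)).false
  filter_upwards [(Finset.eventually_all t).2 hq] with f' hf' x hx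
  obtain ⟨q, hqt, hxq⟩ := hcov x
  exact hf' q hqt x ⟨hx, interior_subset hxq⟩

theorem isClosed_setOf_isCrit (f : C^2⟮I, S; ℝ⟯) : IsClosed {x | IsCrit I f x} := by
  rw [← isOpen_compl_iff, isOpen_iff_mem_nhds]
  intro x hx
  have hxs := mem_chart_source H x
  have hgrad : ∀ y ∈ (chartAt H x).source,
      (IsCrit I f y ↔ gradIn I (chartAt H x) f ((chartAt H x).extend I y) = 0) := fun y hy => by
    rw [gradIn_eq_zero_iff, isCrit_iff (chart_mem x) f.contMDiff hy]
  have hcont := (continuousOn_gradIn (chart_mem x) f.contMDiff).continuousAt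
    ((chartAt H x).open_source.mem_nhds hxs)
  have hne : gradIn I (chartAt H x) f ((chartAt H x).extend I x) ≠ 0 := fun h =>
    hx ((hgrad x hxs).2 h)
  filter_upwards [hcont.eventually_ne hne, (chartAt H x).open_source.mem_nhds hxs] with y hy hys hc
  exact hy ((hgrad y hys).1 hc)

/-- The critical points of a Morse function without critical points on the boundary are finite
in number. -/
theorem finite_setOf_isCrit [CompactSpace S]
    (hK : ∀ q, IsCompact (K q) ∧ K q ⊆ (chartAt H q).source)
    (hcov : ∀ x, ∃ q ∈ t, x ∈ interior (K q))
    (hf : ∀ p, IsCrit I f p → IsInteriorMorsePoint I f p) : {x | IsCrit I f x}.Finite := by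
  have hN : ∀ p, ∃ N ∈ 𝓝 p, ∀ x ∈ N, IsCrit I f x → x = p := fun p => by
    by_cases hp : IsCrit I f p
    · obtain ⟨q, hq, hpq⟩ := hcov p
      obtain ⟨N, hNo, hpN, -, hN⟩ :=
        exists_isOpen_eventually_unique_crit (hK q).2 hq hpq (hf p hp) univ_mem
      -- Persistence applied to the unperturbed `f` shows that its critical points are isolated.
      obtain ⟨p', -, hcrit, -⟩ := (pure_le_jetNhds f hN : _)
      refine ⟨N, hNo.mem_nhds hpN, fun x hx hc => ?_⟩
      rw [(hcrit x hx).1 hc, (hcrit p hpN).1 hp]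
    · exact ⟨_, (isClosed_setOf_isCrit f).isOpen_compl.mem_nhds hp, fun x hx hc => (hx hc).elim⟩
  choose N hN hNu using hN
  obtain ⟨s, hs⟩ := CompactSpace.elim_nhds_subcover N hN
  refine s.finite_toSet.subset fun x hx => ?_
  obtain ⟨p, hp, hxp⟩ := mem_iUnion₂.1 (hs.symm ▸ mem_univ x : x ∈ ⋃ p ∈ s, N p)
  rw [hNu p x hxp hx]
  exact hp

/-- The index distribution of the critical points is locally constant at a Morse function
without critical points on the boundary. -/
theorem eventually_encard_isCrit_eq [CompactSpace S] [T2Space S]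
    (hK : ∀ q, IsCompact (K q) ∧ K q ⊆ (chartAt H q).source)
    (hcov : ∀ x, ∃ q ∈ t, x ∈ interior (K q))
    (hf : ∀ p, IsCrit I f p → IsInteriorMorsePoint I f p) :
    ∀ᶠ f' : C^2⟮I, S; ℝ⟯ in jetNhds I t K f,
      (∀ p, IsCrit I f' p → IsInteriorMorsePoint I f' p) ∧
      ∀ Φ : ℕ → Prop, {p | IsCrit I f' p ∧ Φ (morseIndex I f' p)}.encard =
        {p | IsCrit I f p ∧ Φ (morseIndex I f p)}.encard := by
  have hfin := finite_setOf_isCrit hK hcov hf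
  obtain ⟨U, hU, hdisj⟩ := hfin.t2_separation
  have hN : ∀ p, ∃ N, IsOpen N ∧ (IsCrit I f p → p ∈ N) ∧ N ⊆ U p ∧
      (IsCrit I f p → ∀ᶠ f' : C^2⟮I, S; ℝ⟯ in jetNhds I t K f,
      ∃ p' ∈ N, (∀ x ∈ N, IsCrit I f' x ↔ x = p') ∧ IsInteriorMorsePoint I f' p' ∧
        morseIndex I f' p' = morseIndex I f p) := fun p => by
    by_cases hp : IsCrit I f p
    · obtain ⟨q, hq, hpq⟩ := hcov p
      obtain ⟨N, h1, h2, h3, h4⟩ := exists_isOpen_eventually_unique_crit (hK q).2 hq hpq (hf p hp)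
        ((hU p).2.mem_nhds (hU p).1)
      exact ⟨N, h1, fun _ => h2, h3, fun _ => h4⟩
    · exact ⟨∅, isOpen_empty, fun h => (hp h).elim, empty_subset _, fun h => (hp h).elim⟩
  choose N hNo hpN hNU hNev using hN
  have haway := eventually_forall_not_isCrit (f := f) hK hcov (A := (⋃ p ∈ {x | IsCrit I f x}, N p)ᶜ)
    (isOpen_biUnion fun p _ => hNo p).isClosed_compl fun x hx hc =>
      hx (mem_biUnion hc (hpN x hc))
  filter_upwards [(eventually_all_finite hfin).2 hNev, haway] with f' h1 h2
  -- `σ` follows each critical point of `f` to the one of `f'` in the same neighbourhood. It is onto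
  -- because nothing is critical outside these neighbourhoods, and injective because they lie in
  -- disjoint sets.
  choose! σ hσN hσc hσM hσi using h1
  have hcrit : ∀ x, IsCrit I f' x → ∃ p, IsCrit I f p ∧ x = σ p := fun x hx => by
    by_contra! hne
    refine h2 x (fun hmem => ?_) hx
    obtain ⟨p, hp, hxp⟩ := mem_iUnion₂.1 hmem
    exact hne p hp ((hσc p hp x hxp).1 hx)
  refine ⟨fun x hx => ?_, fun Φ => ?_⟩
  · obtain ⟨p, hp, rfl⟩ := hcrit x hx
    exact hσM p hp
  · have himg : {p | IsCrit I f' p ∧ Φ (morseIndex I f' p)} =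
        σ '' {p | IsCrit I f p ∧ Φ (morseIndex I f p)} := by
      ext x
      constructor
      · rintro ⟨hx, hΦ⟩
        obtain ⟨p, hp, rfl⟩ := hcrit x hx
        exact ⟨p, ⟨hp, by rwa [hσi p hp] at hΦ⟩, rfl⟩
      · rintro ⟨p, ⟨hp, hΦ⟩, rfl⟩
        exact ⟨(hσM p hp).isCrit, by rwa [hσi p hp]⟩
    rw [himg, InjOn.encard_image]
    rintro p ⟨hp, -⟩ p' ⟨hp', -⟩ heq
    by_contra hne
    refine Set.disjoint_left.1 (hdisj hp hp' hne) (hNU p (hσN p hp)) ?_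
    rw [heq]
    exact hNU p' (hσN p' hp')

end Jets

section Counts

variable {D : ℕ} {H : Type*} [TopologicalSpace H]
  {I : ModelWithCorners ℝ (EuclideanSpace ℝ (Fin D)) H}
  {S : Type*} [TopologicalSpace S] [ChartedSpace H S] {f : C^2⟮I, S; ℝ⟯}

/-! ### Numbers of critical points of a Morse function in terms of the Morse index -/

theorem numCrit_eq : numCrit I f = {p | IsCrit I f p ∧ True}.encard := by
  simp [numCrit]

theorem numMorse_eq (hf : ∀ p, IsCrit I f p → IsInteriorMorsePoint I f p) (l : ℕ) :
    numMorse I l f = {p | IsCrit I f p ∧ morseIndex I f p = l}.encard := by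
  rw [numMorse]
  congr 1
  ext p
  exact ⟨fun h => ⟨h.1.1, h.2⟩, fun h => ⟨⟨h.1, (hf p h.1).det_ne_zero⟩, h.2⟩⟩

variable [IsManifold I 2 S] (hf : ∀ p, IsCrit I f p → IsInteriorMorsePoint I f p)
include hf

theorem numMax_eq : numMax I f = {p | IsCrit I f p ∧ morseIndex I f p = D}.encard := by
  rw [numMax]
  congr 1
  ext p
  exact and_congr_right fun h => (hf p h).isStrictLocMax_iff f.contMDiff

theorem numMin_eq : numMin I f = {p | IsCrit I f p ∧ morseIndex I f p = 0}.encard := by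
  rw [numMin]
  congr 1
  ext p
  exact and_congr_right fun h => (hf p h).isStrictLocMin_iff f.contMDiff

/-- The exclusion of undulation points is automatic at nondegenerate critical points, so only the
two extremal indices are removed. -/
theorem numSaddle_eq :
    numSaddle I f =
      {p | IsCrit I f p ∧ (morseIndex I f p ≠ D ∧ morseIndex I f p ≠ 0)}.encard := by
  rw [numSaddle]
  congr 1
  ext p
  refine and_congr_right fun h => ?_
  rw [(hf p h).isStrictLocMax_iff f.contMDiff, (hf p h).isStrictLocMin_iff f.contMDiff]
  exact ⟨fun h => ⟨h.1, h.2.1⟩, fun h' =>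
    ⟨h'.1, h'.2, not_isUndulation_of_det_ne_zero (hf p h).det_ne_zero⟩⟩

end Counts

end MorseConv

end

/-! ### Weak convergence of the numbers of critical points -/

theorem mainTheorem7
    -- a compact `C²` manifold with boundary `S` of dimension `D`, which is also a metric space
    {D : ℕ} {H : Type*} [TopologicalSpace H]
    (I : ModelWithCorners ℝ (EuclideanSpace ℝ (Fin D)) H)
    {S : Type*} [MetricSpace S] [CompactSpace S] [ChartedSpace H S] [IsManifold I 2 S]
    -- random processes `Ghat n` and `G` with values in `C²(S, ℝ)`
    {Ω : ℕ → Type*} [∀ n, MeasurableSpace (Ω n)]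
    (P : ∀ n, Measure (Ω n)) [∀ n, IsProbabilityMeasure (P n)]
    {Ω' : Type*} [MeasurableSpace Ω'] (Q : Measure Ω') [IsProbabilityMeasure Q]
    (Ghat : ∀ n, Ω n → C^2⟮I, S; ℝ⟯) (G : Ω' → C^2⟮I, S; ℝ⟯)
    -- weak convergence of `(f, ∇f, H_f)`, that is, in `C²(S, ℝ)`, to a separable limit
    (hweak : MorseConv.WeakConv P Ghat Q G)
    (hsep : MorseConv.IsSeparableRV Q G)
    -- almost surely no critical points on the boundary
    (hbdry : ∀ᵐ ω ∂Q, ∀ p ∈ I.boundary S, ¬ MorseConv.IsCrit I (G ω) p)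
    -- almost surely Morse
    (hmorse : ∀ᵐ ω ∂Q, MorseConv.IsMorse I (G ω))
    (hmeas : ∀ l : ℕ, Measurable fun ω => MorseConv.numMorse I l (G ω)) :
    (∀ᵐ ω ∂Q, MorseConv.numCrit I (G ω) < ⊤) ∧
    MorseConv.WeakConv P (fun n ω => MorseConv.numMax I (Ghat n ω))
      Q (fun ω => MorseConv.numMax I (G ω)) ∧
    MorseConv.WeakConv P (fun n ω => MorseConv.numMin I (Ghat n ω))
      Q (fun ω => MorseConv.numMin I (G ω)) ∧
    MorseConv.WeakConv P (fun n ω => MorseConv.numSaddle I (Ghat n ω))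
      Q (fun ω => MorseConv.numSaddle I (G ω)) ∧
    MorseConv.WeakConv P (fun n ω => MorseConv.numCrit I (Ghat n ω))
      Q (fun ω => MorseConv.numCrit I (G ω)) ∧
    ∀ l ≤ D, MorseConv.WeakConv P (fun n ω => MorseConv.numMorse I l (Ghat n ω))
      Q (fun ω => MorseConv.numMorse I l (G ω)) := by
  open MorseConv in
  have hK : ∀ q : S, ∃ K ∈ 𝓝 q, K ⊆ (chartAt H q).source ∧ IsCompact K := fun q =>
    local_compact_nhds ((chartAt H q).open_source.mem_nhds (mem_chart_source H q))
  choose K hKn hKs hKc using hK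
  have hK : ∀ q, IsCompact (K q) ∧ K q ⊆ (chartAt H q).source := fun q => ⟨hKc q, hKs q⟩
  obtain ⟨t, ht⟩ := CompactSpace.elim_nhds_subcover (fun q => interior (K q))
    fun q => interior_mem_nhds.2 (hKn q)
  have hcov : ∀ x, ∃ q ∈ t, x ∈ interior (K q) := fun x => by
    simpa using (ht.symm ▸ mem_univ x : x ∈ ⋃ q ∈ t, interior (K q))
  have hgood : ∀ᵐ ω ∂Q, ∀ p, IsCrit I (G ω) p → IsInteriorMorsePoint I (G ω) p := by
    filter_upwards [hbdry, hmorse] with ω h1 h2 p hp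
    refine ⟨hp, ?_, h2 p hp⟩
    by_contra hn
    exact h1 p ((I.isBoundaryPoint_iff_not_isInteriorPoint p).2 hn) hp
  -- The index formula for `N` is needed only at good functions: near a good function every function
  -- is good, so the formula applies on both sides of the comparison.
  have hpass : ∀ N : C^2⟮I, S; ℝ⟯ → ℕ∞,
      (∃ Φ : ℕ → Prop, ∀ f : C^2⟮I, S; ℝ⟯, (∀ p, IsCrit I f p → IsInteriorMorsePoint I f p) →
        N f = {p | IsCrit I f p ∧ Φ (morseIndex I f p)}.encard) →
      WeakConv P (fun n ω => N (Ghat n ω)) Q (fun ω => N (G ω)) := by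
    rintro N ⟨Φ, hΦ⟩
    refine hweak.map_of_eventually_eq' (continuous_compactJet (I := I) (t := t) hK) N ?_
    filter_upwards [hgood] with ω hω
    filter_upwards [eventually_encard_isCrit_eq hK hcov hω] with f' hf'
    rw [hΦ _ hω, hΦ _ hf'.1, hf'.2]
  refine ⟨?_, hpass (fun f => numMax I f) ⟨fun k => k = D, fun f hf => numMax_eq hf⟩,
    hpass (fun f => numMin I f) ⟨fun k => k = 0, fun f hf => numMin_eq hf⟩,
    hpass (fun f => numSaddle I f) ⟨fun k => k ≠ D ∧ k ≠ 0, fun f hf => numSaddle_eq hf⟩,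
    hpass (fun f => numCrit I f) ⟨fun _ => True, fun f hf => numCrit_eq⟩,
    fun l _ => hpass (fun f => numMorse I l f) ⟨fun k => k = l, fun f hf => numMorse_eq hf l⟩⟩
  filter_upwards [hgood] with ω hω
  exact (finite_setOf_isCrit hK hcov hω).encard_lt_top
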